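/- Let $G=\mathrm{PSL}(2,\mathbb R)$, acting on the upper half-plane $\mathbb H$ by Möbius transformations, let $\tilde G\to G$ be its universal covering group with centre $Z(\tilde G)$, and for a positive integer $m$ let $G_m=\tilde G/(m\cdot Z(\tilde G))$ be the $m$-fold covering group of $G$, where $m\cdot Z(\tilde G)=\{z^m : z\in Z(\tilde G)\}$. **Levels.** Let $u\in\tilde G$ be the end point of the lift, starting at the identity, of the path $s\mapsto\rho(2\pi s)$, $0\le s\le 1$, where $\rho(\varphi)=\left[\begin{smallmatrix}\cos\frac{\varphi}{2}&\sin\frac{\varphi}{2}\\-\sin\frac{\varphi}{2}&\cos\frac{\varphi}{2}\end{smallmatrix}\right]$ is the counterclockwise rotation of $\mathbb H$ through the angle $\varphi$ about $i$; $u$ generates $Z(\tilde G)$. Let $\Xi\subset G$ be the set of all hyperbolic and parabolic elements together with the identity. An element of $\tilde G$ with hyperbolic or parabolic image in $G$ has level $k\in\mathbb Z$ if it lies in the same connected component of the preimage of $\Xi$ in $\tilde G$ as $u^k$. The level $\mathrm{lev}_m(x)\in\mathbb Z/m\mathbb Z$ of an element $x\in G_m$ with hyperbolic or parabolic image is the level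 modulo $m$ of any of its representatives in $\tilde G$. **Sequential sets.** For real $\alpha<\beta$ and $\lambda>1$, the element $\tau_{\alpha,\beta}(\lambda)=\left[\frac{1}{(\alpha-\beta)\sqrt\lambda}\left(\begin{smallmatrix}\lambda\alpha-\beta&-(\lambda-1)\alpha\beta\\ \lambda-1&\alpha-\lambda\beta\end{smallmatrix}\right)\right]$ is called positive (it is hyperbolic with attracting fixed point $\alpha$ and repelling fixed point $\beta$). For real $\alpha$ and $\lambda>0$, the parabolic element $\pi_\alpha(\lambda)=\left[\begin{smallmatrix}1-\lambda\alpha&\lambda\alpha^2\\-\lambda&1+\lambda\alpha\end{smallmatrix}\right]$ is called positive. A triple $(C_1,C_2,C_3)$ of hyperbolic or parabolic elements of $G$ is sequential if $C_1C_2C_3=1$ and for some $A\in G$ the elements $\tilde C_i=AC_iA^{-1}$ are positive, with finite fixed points, and every fixed point of $\tilde C_1$ is smaller than every fixed point of $\tilde C_2$, and every fixed point of $\tilde C_2$ is smaller than every fixed point of $\tilde C_3$. A tuple $(C_1,\dots,C_N)$ in $G$ with $N=l_h+l_p$ is a sequential set of type $(0,l_h,l_p)$ if $C_1,\dots,C_{l_h}$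 are hyperbolic, $C_{l_h+1},\dots,C_N$ are parabolic, and the triple $(C_1\cdots C_{j-1},\,C_j,\,C_{j+1}\cdots C_N)$ is sequential for every $j\in\{2,\dots,N-1\}$. With $n=g+l_h+l_p$, a tuple $(A_1,\dots,A_g,B_1,\dots,B_g,C_{g+1},\dots,C_n)$ in $G$ is a sequential set of type $(g,l_h,l_p)$ if all $A_i$, $B_i$ and $C_{g+1},\dots,C_{g+l_h}$ are hyperbolic, $C_{g+l_h+1},\dots,C_n$ are parabolic, and $(A_1,B_1A_1^{-1}B_1^{-1},\dots,A_g,B_gA_g^{-1}B_g^{-1},C_{g+1},\dots,C_n)$ is a sequential set of type $(0,2g+l_h,l_p)$. **Statement.** Let $m\ge 1$, let $g,l_h,l_p\ge 0$ be integers with $2g+l_h+l_p\ge 3$, and put $n=g+l_h+l_p$. Let $A_i,B_i$ $(i=1,\dots,g)$ and $C_i$ $(i=g+1,\dots,n)$ be elements of $G_m$ whose images in $G$ form a sequential set of type $(g,l_h,l_p)$. Then $$\prod_{i=1}^g[A_i,B_i]\cdot\prod_{i=g+1}^n C_i=e\quad\text{in }G_m$$ (where $[A,B]=ABA^{-1}B^{-1}$)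 if and only if $$\sum_{i=g+1}^n\mathrm{lev}_m(C_i)=(2-2g)-(n-g)\quad\text{in }\mathbb Z/m\mathbb Z.$$ In particular, for $n=g$ the relation holds if and only if $2-2g\equiv 0\pmod m$. -/

import Mathlib

open scoped MatrixGroups unitInterval

noncomputable section

namespace LevelLift

/-! ### The universal covering group of a topological group -/

section UniversalCover

variable (H : Type*) [Group H] [TopologicalSpace H] [IsTopologicalGroup H]

/-- The group, under pointwise multiplication, of all paths in `H` that start at `1`. -/
def PathGroup : Subgroup C(I, H) where
  carrier := {γ | γ 0 = 1}
  mul_mem' := by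
    intro a b ha hb
    simp only [Set.mem_ofPred_eq] at ha hb ⊢
    simp [ha, hb]
  one_mem' := by simp
  inv_mem' := by
    intro a ha
    simp only [Set.mem_ofPred_eq] at ha ⊢
    simp [ha]

variable {H} in
theorem homotopicRel_mul {f₀ f₁ g₀ g₁ : C(I, H)} {S : Set I}
    (hf : f₀.HomotopicRel f₁ S) (hg : g₀.HomotopicRel g₁ S) :
    (f₀ * g₀).HomotopicRel (f₁ * g₁) S := by
  obtain ⟨F⟩ := hf
  obtain ⟨G⟩ := hg
  exact ⟨(F.prod G).compContinuousMap (⟨fun p : H × H => p.1 * p.2, continuous_mul⟩ : C(H × H, H))⟩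

variable {H} in
theorem homotopicRel_inv {f₀ f₁ : C(I, H)} {S : Set I}
    (hf : f₀.HomotopicRel f₁ S) : (f₀⁻¹).HomotopicRel (f₁⁻¹) S := by
  obtain ⟨F⟩ := hf
  exact ⟨F.compContinuousMap (⟨fun p : H => p⁻¹, continuous_inv⟩ : C(H, H))⟩

/-- The subgroup of the loops at `1` that are homotopic, relative to the end points, to the
constant path. Two paths `γ`, `γ'` starting at `1` are homotopic relative to the end points if and
only if `γ⁻¹ * γ'` lies in this subgroup. -/
def NullLoops : Subgroup (PathGroup H) where
  carrier := {γ | (γ : C(I, H)).HomotopicRel 1 {0, 1}}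
  mul_mem' := by
    intro a b ha hb
    simpa using homotopicRel_mul ha hb
  one_mem' := ContinuousMap.HomotopicRel.refl _
  inv_mem' := by
    intro a ha
    simpa using homotopicRel_inv ha

instance : (NullLoops H).Normal where
  conj_mem := by
    intro n hn g
    have h := homotopicRel_mul (homotopicRel_mul
      (ContinuousMap.HomotopicRel.refl (S := {0, 1}) (g : C(I, H))) hn)
      (ContinuousMap.HomotopicRel.refl (S := {0, 1}) ((g : C(I, H))⁻¹))
    simpa [NullLoops] using h

/-- The universal covering group of `H` (for `H` connected and locally nice, such as a connected
Lie group): homotopy classes, relative to the end points, of paths starting at `1`, multiplied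
pointwise. -/
abbrev UniversalCover : Type _ := PathGroup H ⧸ NullLoops H

/-- The end point of a path, as a homomorphism. -/
def endpointHom : PathGroup H →* H where
  toFun γ := (γ : C(I, H)) 1
  map_one' := by simp
  map_mul' := by intro a b; simp

/-- The covering homomorphism: the class of a path is sent to the end point of the path. -/
def UniversalCover.proj : UniversalCover H →* H :=
  QuotientGroup.lift (NullLoops H) (endpointHom H) (by
    intro γ hγ
    have h : (γ : C(I, H)) 1 = (1 : C(I, H)) 1 :=
      ContinuousMap.HomotopicRel.fst_eq_snd hγ (by simp)
    exact h)

end UniversalCover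

/-! ### The group `G = PSL(2, ℝ)` and its elements -/

/-- `G = PSL(2, ℝ)`, with the quotient topology. -/
abbrev G : Type := PSL(2, ℝ)

/-- The class in `G` of a matrix of determinant `1`. -/
def cls (A : SL(2, ℝ)) : G := QuotientGroup.mk A

def IsHyperbolic (x : G) : Prop := ∃ A : SL(2, ℝ), cls A = x ∧ A.val.IsHyperbolic

/-- The identity is not parabolic. -/
def IsParabolic (x : G) : Prop := ∃ A : SL(2, ℝ), cls A = x ∧ A.val.IsParabolic

/-- The hyperbolic element `τ_{α,β}(l)` with real fixed points `α ≠ β`. -/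
def tau (α β l : ℝ) (h : α ≠ β) (hl : 0 < l) : G :=
  cls ⟨(1 / ((α - β) * √l)) • !![l * α - β, -((l - 1) * α * β); l - 1, α - l * β], by
    have h1 : α - β ≠ 0 := sub_ne_zero.mpr h
    have h2 : √l ≠ 0 := (Real.sqrt_pos.mpr hl).ne'
    have h3 : √l ^ 2 = l := Real.sq_sqrt hl.le
    rw [Matrix.det_smul, Matrix.det_fin_two_of]
    simp only [Fintype.card_fin]
    field_simp
    rw [h3]
    ring⟩

/-- The parabolic element `π_α(l)` with real fixed point `α`. -/
def par (α l : ℝ) : G :=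
  cls ⟨!![1 - l * α, l * α ^ 2; -l, 1 + l * α], by
    rw [Matrix.det_fin_two_of]
    ring⟩

/-- `x` is hyperbolic or parabolic with finite fixed points, and positive: `x = τ_{α,β}(l)` with
`l > 1`, `α < β`, or `x = π_α(l)` with `l > 0`. -/
def IsPositive (x : G) : Prop :=
  (∃ (α β l : ℝ) (h : α < β) (hl : 1 < l), x = tau α β l h.ne (zero_lt_one.trans hl)) ∨
    ∃ α l : ℝ, 0 < l ∧ x = par α l

/-- The real number `t` is a fixed point of the Möbius transformation `x`. (The denominator
`c t + d` cannot vanish when the equation holds.) -/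
def FixesReal (x : G) (t : ℝ) : Prop :=
  ∃ A : SL(2, ℝ), cls A = x ∧ A.val 0 0 * t + A.val 0 1 = t * (A.val 1 0 * t + A.val 1 1)

/-- All fixed points of `x` are smaller than all fixed points of `y`. -/
def FixLT (x y : G) : Prop := ∀ s t : ℝ, FixesReal x s → FixesReal y t → s < t

/-! ### Sequential sets -/

/-- A triple of hyperbolic or parabolic elements with product `1` that becomes, after a
simultaneous conjugation, a triple of positive elements with finite fixed points in increasing
order. -/
def IsSequentialTriple (C₁ C₂ C₃ : G) : Prop :=
  C₁ * C₂ * C₃ = 1 ∧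
    ∃ A : G, IsPositive (A * C₁ * A⁻¹) ∧ IsPositive (A * C₂ * A⁻¹) ∧ IsPositive (A * C₃ * A⁻¹) ∧
      FixLT (A * C₁ * A⁻¹) (A * C₂ * A⁻¹) ∧ FixLT (A * C₂ * A⁻¹) (A * C₃ * A⁻¹)

/-- Sequential sets of type `(0, lh, lp)`: the tuple `C = (C₁, …, Cₙ)`, `n = lh + lp`, has its
first `lh` members hyperbolic and the others parabolic, and
`(C₁ ⋯ C_{j-1}, C_j, C_{j+1} ⋯ Cₙ)` is a sequential triple for every `1 < j < n`. -/
def IsSequentialGenusZero (lh lp : ℕ) (C : List G) : Prop :=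
  C.length = lh + lp ∧ (∀ x ∈ C.take lh, IsHyperbolic x) ∧ (∀ x ∈ C.drop lh, IsParabolic x) ∧
    ∀ (L : List G) (x : G) (R : List G), C = L ++ x :: R → L ≠ [] → R ≠ [] →
      IsSequentialTriple L.prod x R.prod

/-- Sequential sets of type `(g, lh, lp)`. -/
def IsSequential (g lh lp : ℕ) (A B : Fin g → G) (C : Fin (lh + lp) → G) : Prop :=
  (∀ i, IsHyperbolic (A i)) ∧ (∀ i, IsHyperbolic (B i)) ∧
    (∀ i : Fin (lh + lp), (i : ℕ) < lh → IsHyperbolic (C i)) ∧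
    (∀ i : Fin (lh + lp), lh ≤ (i : ℕ) → IsParabolic (C i)) ∧
    IsSequentialGenusZero (2 * g + lh) lp
      ((List.ofFn fun i => [A i, B i * (A i)⁻¹ * (B i)⁻¹]).flatten ++ List.ofFn C)

/-! ### The universal cover `G̃`, its central element `u`, and the coverings `G_m` -/

/-- The universal covering group of `PSL(2, ℝ)`. -/
abbrev Gtilde : Type := UniversalCover G

/-- The matrix inducing the (counterclockwise) rotation of the upper half-plane through the angle
`φ` about the point `i`. -/
def rotMatrix (φ : ℝ) : SL(2, ℝ) :=
  ⟨!![Real.cos (φ / 2), Real.sin (φ / 2); -Real.sin (φ / 2), Real.cos (φ / 2)], by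
    rw [Matrix.det_fin_two_of]
    nlinarith [Real.sin_sq_add_cos_sq (φ / 2)]⟩

theorem continuous_cls : Continuous cls := continuous_quot_mk

theorem continuous_rotMatrix : Continuous rotMatrix := by
  refine Continuous.subtype_mk ?_ _
  refine continuous_matrix ?_
  intro i j
  fin_cases i <;> fin_cases j <;> simp <;> fun_prop

/-- The path `s ↦ ρ_i(2πs)`, `0 ≤ s ≤ 1`, in `G`. -/
def fullTurn : PathGroup G :=
  ⟨⟨fun s => cls (rotMatrix (2 * Real.pi * s)),
    continuous_cls.comp (continuous_rotMatrix.comp (by fun_prop))⟩, by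
    change cls (rotMatrix (2 * Real.pi * ((0 : I) : ℝ))) = 1
    have : rotMatrix (2 * Real.pi * ((0 : I) : ℝ)) = 1 := by
      ext i j
      fin_cases i <;> fin_cases j <;> simp [rotMatrix]
    rw [this]
    rfl⟩

/-- The generator `u` of the centre of `G̃`: the lift to `G̃` of the rotation through `2π`. -/
def u : Gtilde := QuotientGroup.mk fullTurn

/-- The set `Ξ` of all hyperbolic and parabolic elements of `G`, with the identity. -/
def Xi : Set G := {x | IsHyperbolic x ∨ IsParabolic x ∨ x = 1}

/-- `x` lies in the same component of the preimage of `Ξ` in `G̃` as `u ^ k`, i.e. some path in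
this preimage leads from `u ^ k` to `x`. Such a path is the lift starting at `u ^ k` of a path `γ`
in `Ξ` from `1` to the image of `x`, and the end point of this lift is the class of `γ` times
`u ^ k`. -/
def AtLevel (x : Gtilde) (k : ℤ) : Prop :=
  ∃ γ : PathGroup G, (∀ s : I, (γ : C(I, G)) s ∈ Xi) ∧ x = QuotientGroup.mk γ * u ^ k

open Classical in
/-- The level function `s` on `G̃`; meaningful for hyperbolic and parabolic elements. -/
def level (x : Gtilde) : ℤ := if h : ∃ k, AtLevel x k then h.choose else 0

/-- The subgroup `m · Z(G̃)` of the `m`-th powers of the central elements of `G̃`. -/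
def mCenter (m : ℕ) : Subgroup Gtilde where
  carrier := {x | ∃ z ∈ Subgroup.center Gtilde, z ^ m = x}
  mul_mem' := by
    rintro _ _ ⟨y, hy, rfl⟩ ⟨z, hz, rfl⟩
    have h : Commute y z := Subgroup.mem_center_iff.mp hz y
    exact ⟨y * z, mul_mem hy hz, h.mul_pow m⟩
  one_mem' := ⟨1, one_mem _, one_pow m⟩
  inv_mem' := by
    rintro _ ⟨z, hz, rfl⟩
    exact ⟨z⁻¹, inv_mem hz, inv_pow z m⟩

theorem mCenter_le_center (m : ℕ) : mCenter m ≤ Subgroup.center Gtilde := by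
  rintro x ⟨z, hz, rfl⟩
  exact pow_mem hz m

instance (m : ℕ) : (mCenter m).Normal where
  conj_mem := by
    intro n hn g
    have h := Subgroup.mem_center_iff.mp (mCenter_le_center m hn) g
    rw [h]
    simpa using hn

/-- The `m`-fold covering group `G_m = G̃ / (m · Z(G̃))` of `G`. -/
abbrev Gm (m : ℕ) : Type := Gtilde ⧸ mCenter m

theorem cls_mem_range (f : ℝ → SL(2, ℝ)) (hf : Continuous f) (h0 : f 0 = 1) :
    ∃ x : Gtilde, UniversalCover.proj G x = cls (f 1) := by
  refine ⟨QuotientGroup.mk ⟨⟨fun s => cls (f s),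
    continuous_cls.comp (hf.comp (by fun_prop))⟩, ?_⟩, ?_⟩
  · change cls (f ((0 : I) : ℝ)) = 1
    simp only [Set.Icc.coe_zero, h0]
    rfl
  · change cls (f ((1 : I) : ℝ)) = cls (f 1)
    simp

theorem val_eq_or_of_cls_eq {A B : SL(2, ℝ)} (h : cls A = cls B) :
    B.val = A.val ∨ B.val = -A.val := by
  have h1 : A⁻¹ * B ∈ Subgroup.center SL(2, ℝ) := QuotientGroup.eq.mp h
  obtain ⟨r, hr, hr'⟩ := Matrix.SpecialLinearGroup.mem_center_iff.mp h1
  have hB : B.val = A.val * (A⁻¹ * B).val := by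
    rw [← Matrix.SpecialLinearGroup.coe_mul]
    simp
  have hr2 : r ^ 2 = 1 := by simpa using hr
  rw [← hr'] at hB
  rcases (by grind : r = 1 ∨ r = -1) with h | h
  · left; simpa [h] using hB
  · right
    rw [hB, h, map_neg, map_one, mul_neg, mul_one]

theorem center_le_ker : Subgroup.center Gtilde ≤ (UniversalCover.proj G).ker := by
  intro z hz
  obtain ⟨A, hA⟩ : ∃ A : SL(2, ℝ), cls A = UniversalCover.proj G z :=
    QuotientGroup.mk_surjective _
  have key : ∀ f : ℝ → SL(2, ℝ), Continuous f → f 0 = 1 →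
      (f 1).val * A.val = A.val * (f 1).val ∨ (f 1).val * A.val = -(A.val * (f 1).val) := by
    intro f hf h0
    obtain ⟨x, hx⟩ := cls_mem_range f hf h0
    have h := congrArg (UniversalCover.proj G) (Subgroup.mem_center_iff.mp hz x)
    rw [map_mul, map_mul, hx, ← hA] at h
    have h2 := val_eq_or_of_cls_eq (A := A * f 1) (B := f 1 * A) h.symm
    simpa only [Matrix.SpecialLinearGroup.coe_mul] using h2
  have hdet : A.val 0 0 * A.val 1 1 - A.val 0 1 * A.val 1 0 = 1 := by
    rw [← Matrix.det_fin_two]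
    exact A.2
  have hU := key (fun s => ⟨!![1, s; 0, 1], by simp [Matrix.det_fin_two_of]⟩)
    (by
      refine Continuous.subtype_mk (continuous_matrix fun i j => ?_) _
      fin_cases i <;> fin_cases j <;> simp <;> fun_prop)
    (by ext i j; fin_cases i <;> fin_cases j <;> simp)
  have hL := key (fun s => ⟨!![1, 0; s, 1], by simp [Matrix.det_fin_two_of]⟩)
    (by
      refine Continuous.subtype_mk (continuous_matrix fun i j => ?_) _
      fin_cases i <;> fin_cases j <;> simp <;> fun_prop)
    (by ext i j; fin_cases i <;> fin_cases j <;> simp)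
  simp only [← Matrix.ext_iff, Fin.forall_fin_two, Matrix.mul_apply, Fin.sum_univ_two, Matrix.neg_apply, Matrix.of_apply,
    Matrix.cons_val', Matrix.cons_val_zero,
    Matrix.cons_val_one, Matrix.cons_val_fin_one] at hU hL
  have hc : A.val 1 0 = 0 := by
    rcases hU with h | h <;> grind
  have hb : A.val 0 1 = 0 := by
    rcases hL with h | h <;> grind
  have had : A.val 0 0 = A.val 1 1 := by
    rcases hU with h | h <;> grind
  rw [MonoidHom.mem_ker, ← hA]
  refine (QuotientGroup.eq_one_iff A).mpr (Matrix.SpecialLinearGroup.mem_center_iff.mpr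
    ⟨A.val 0 0, ?_, ?_⟩)
  · simp only [Fintype.card_fin]
    rw [hc, ← had] at hdet
    linarith
  · ext i j
    fin_cases i <;> fin_cases j <;> simp [hc, hb, had]

/-- The covering homomorphism `G_m → G`. -/
def Gm.proj (m : ℕ) : Gm m →* G :=
  QuotientGroup.lift (mCenter m) (UniversalCover.proj G)
    (fun _ hx => center_le_ker (mCenter_le_center m hx))

/-- The level function `lev_m` on `G_m`, with values in `ℤ/m`: the level modulo `m` of a
representative in `G̃`. -/
def lev (m : ℕ) (x : Gm m) : ZMod m := (level (Quotient.out x) : ZMod m)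

end LevelLift

end

noncomputable section

namespace LevelLift

/-! The group `G` acts on the boundary circle of the half-plane, so `G̃` acts on the line covering
it by increasing maps commuting with translation by `2π` (`act`). Here `u` is the translation by
`2π`, and the kernel of `G̃ → G` consists of the powers of `u` (`exists_eq_u_zpow`). Levels can be
read off on the line: an element of level `k` moves every lift of a boundary fixed point by exactly
`2πk` (`HasLevel`, `AtLevel.hasLevel`). Along a path in `Ξ` a fixed point always exists, and its
displacement, an integral multiple of `2π`, cannot jump.

The geometric core is `mul_eq_u_of_isPositive`. Lift a sequential triple of positive elements to
level `0`. The product lies over `1`, hence is some `u ^ k`. Each factor moves the lift `0` of `∞`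
to the right, so `k > 0`; the fixed points of the factors act as barriers that force `k < 2`. Thus
the product is `u`, and for lifts of levels `i, j, k` it is `u ^ (i + j + k + 1)`.

Applying this to the triples in the definition of a sequential set, by induction on the length of an
initial segment, shows that the product of `N` lifts is `u` to the power (sum of levels) `+ N - 2`
(`prod_eq_u_zpow`). A commutator is the product of `A` and `B A⁻¹ B⁻¹`, whose levels cancel, so each
handle adds just `2` to `N`. Finally `u ^ k` dies in `G_m` exactly when `m ∣ k`. -/

/-! ### The action on the boundary circle -/

/-- The vector spanning the boundary point with angular coordinate `t`. The rotation
`rotMatrix φ` increases the coordinate by `φ`. -/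
def vec (t : ℝ) : Fin 2 → ℝ := ![Real.cos (t / 2), -Real.sin (t / 2)]

theorem vec_ne_zero (t : ℝ) : vec t ≠ 0 := by
  intro h
  have h0 : Real.cos (t / 2) = 0 := congrFun h 0
  have h1 : -Real.sin (t / 2) = 0 := congrFun h 1
  nlinarith [Real.sin_sq_add_cos_sq (t / 2)]

theorem continuous_vec : Continuous vec := by
  refine continuous_pi fun i => ?_
  fin_cases i <;> simp [vec] <;> fun_prop

theorem mulVec_ne_zero (A : SL(2, ℝ)) {v : Fin 2 → ℝ} (hv : v ≠ 0) : A.val.mulVec v ≠ 0 := by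
  intro h
  apply hv
  have h1 : (A⁻¹ * A).val.mulVec v = 0 := by
    rw [Matrix.SpecialLinearGroup.coe_mul, ← Matrix.mulVec_mulVec, h, Matrix.mulVec_zero]
  simpa using h1

/-- A vector of `ℝ²` as a complex number. -/
def toComplex (v : Fin 2 → ℝ) : ℂ := ⟨v 0, v 1⟩

theorem toComplex_ne_zero {v : Fin 2 → ℝ} (hv : v ≠ 0) : toComplex v ≠ 0 := by
  intro h
  apply hv
  ext i
  fin_cases i
  · exact congrArg Complex.re h
  · exact congrArg Complex.im h

theorem continuous_toComplex : Continuous toComplex := by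
  have : toComplex = fun v => ((v 0 : ℝ) : ℂ) + ((v 1 : ℝ) : ℂ) * Complex.I := by
    ext v
    apply Complex.ext <;> simp [toComplex]
  rw [this]
  fun_prop

theorem toComplex_smul (r : ℝ) (v : Fin 2 → ℝ) : toComplex (r • v) = r * toComplex v := by
  apply Complex.ext <;> simp [toComplex]

/-- The point of the circle that corresponds to the line spanned by a nonzero vector. -/
def linePt (v : Fin 2 → ℝ) (hv : v ≠ 0) : Circle :=
  Circle.ofConjDivSelf (toComplex v) (toComplex_ne_zero hv)

theorem coe_linePt (v : Fin 2 → ℝ) (hv : v ≠ 0) :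
    (linePt v hv : ℂ) = (starRingEnd ℂ) (toComplex v) / toComplex v := rfl

theorem linePt_smul {r : ℝ} (hr : r ≠ 0) {v : Fin 2 → ℝ} (hv : v ≠ 0) (h : r • v ≠ 0) :
    linePt (r • v) h = linePt v hv := by
  have hz := toComplex_ne_zero hv
  have hr' : (r : ℂ) ≠ 0 := by exact_mod_cast hr
  apply Circle.ext
  rw [coe_linePt, coe_linePt, toComplex_smul, map_mul, Complex.conj_ofReal]
  field_simp

theorem toComplex_vec (t : ℝ) : toComplex (vec t) = Complex.exp (-(t / 2 : ℝ) * Complex.I) := by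
  have : (-(t / 2 : ℝ) * Complex.I : ℂ) = ((-(t / 2) : ℝ) : ℂ) * Complex.I := by push_cast; ring
  rw [this, Complex.exp_mul_I, ← Complex.ofReal_cos, ← Complex.ofReal_sin]
  apply Complex.ext <;> simp [toComplex, vec, -Complex.ofReal_cos, -Complex.ofReal_sin]

theorem conj_toComplex_vec (t : ℝ) :
    (starRingEnd ℂ) (toComplex (vec t)) = Complex.exp ((t / 2 : ℝ) * Complex.I) := by
  rw [toComplex_vec, ← Complex.exp_conj]
  congr 1
  rw [map_mul, map_neg, Complex.conj_ofReal, Complex.conj_I]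
  ring

theorem linePt_vec (t : ℝ) (h : vec t ≠ 0) : linePt (vec t) h = Circle.exp t := by
  apply Circle.ext
  rw [coe_linePt, conj_toComplex_vec, toComplex_vec, ← Complex.exp_sub, Circle.coe_exp]
  congr 1
  push_cast
  ring

theorem exists_smul_vec_of_linePt {v : Fin 2 → ℝ} (hv : v ≠ 0) {t : ℝ}
    (h : linePt v hv = Circle.exp t) : ∃ r : ℝ, r ≠ 0 ∧ v = r • vec t := by
  have h1 := congrArg (fun z : Circle => (z : ℂ)) h
  simp only [coe_linePt, Circle.coe_exp] at h1
  have hz := toComplex_ne_zero hv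
  rw [div_eq_iff hz] at h1
  -- With `z = toComplex v`, the hypothesis reads `conj z = e^{it} z`; hence `z e^{it/2}` is its own
  -- conjugate, a real number `r`, and `z = r e^{-it/2}`.
  set w := toComplex v * Complex.exp ((t / 2 : ℝ) * Complex.I) with hw
  have hwr : (starRingEnd ℂ) w = w := by
    have hE : (starRingEnd ℂ) (Complex.exp ((t / 2 : ℝ) * Complex.I)) =
        Complex.exp (-(t / 2 : ℝ) * Complex.I) := by
      rw [← conj_toComplex_vec, Complex.conj_conj, toComplex_vec]
    rw [hw, map_mul, h1, hE, mul_comm (Complex.exp _) (toComplex v), mul_assoc, ← Complex.exp_add]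
    congr 2
    push_cast
    ring
  obtain ⟨r, hr⟩ := Complex.conj_eq_iff_real.mp hwr
  have hv2 : toComplex v = toComplex (r • vec t) := by
    rw [toComplex_smul, toComplex_vec, ← hr, hw, mul_assoc, ← Complex.exp_add]
    simp
  have hv3 : v = r • vec t := by
    ext i
    fin_cases i
    · exact congrArg Complex.re hv2
    · exact congrArg Complex.im hv2
  refine ⟨r, ?_, hv3⟩
  rintro rfl
  exact hv (by simpa using hv3)

/-- The image under `x` of the boundary point with coordinate `t`. -/
def bdry (x : G) (t : ℝ) : Circle :=
  Quotient.liftOn' x (fun A : SL(2, ℝ) =>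
    linePt (A.val.mulVec (vec t)) (mulVec_ne_zero A (vec_ne_zero t))) (by
    intro A B hAB
    have h : cls A = cls B := Quotient.sound' hAB
    rcases val_eq_or_of_cls_eq h with h | h
    · simp only [h]
    · have h2 : B.val.mulVec (vec t) = (-1 : ℝ) • A.val.mulVec (vec t) := by
        rw [h, Matrix.neg_mulVec, neg_one_smul]
      simp only [h2]
      exact (linePt_smul (by norm_num) _ _).symm)

theorem bdry_cls (A : SL(2, ℝ)) (t : ℝ) :
    bdry (cls A) t = linePt (A.val.mulVec (vec t)) (mulVec_ne_zero A (vec_ne_zero t)) := rfl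

theorem bdry_cls_eq_exp_iff {A : SL(2, ℝ)} {t t' : ℝ} :
    bdry (cls A) t = Circle.exp t' ↔ ∃ r : ℝ, r ≠ 0 ∧ A.val.mulVec (vec t) = r • vec t' := by
  rw [bdry_cls]
  refine ⟨exists_smul_vec_of_linePt _, ?_⟩
  rintro ⟨r, hr, h⟩
  rw [← linePt_vec t' (vec_ne_zero t'), ← linePt_smul hr (vec_ne_zero t')
    (smul_ne_zero hr (vec_ne_zero t'))]
  simp only [h]

theorem cls_surjective : Function.Surjective cls := QuotientGroup.mk_surjective

theorem bdry_one (t : ℝ) : bdry 1 t = Circle.exp t :=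
  bdry_cls_eq_exp_iff (A := 1).mpr ⟨1, one_ne_zero, by simp⟩

/-- `bdry` takes a real coordinate and returns a point of the circle, so composition has to pass
through a coordinate `t'` of the intermediate point. -/
theorem bdry_mul {x y : G} {t t' : ℝ} (h : bdry y t = Circle.exp t') :
    bdry (x * y) t = bdry x t' := by
  obtain ⟨A, rfl⟩ := cls_surjective x
  obtain ⟨B, rfl⟩ := cls_surjective y
  obtain ⟨r, hr, hB⟩ := bdry_cls_eq_exp_iff.mp h
  obtain ⟨t'', ht''⟩ := Circle.exp_surjective (bdry (cls A) t')
  obtain ⟨q, hq, hA⟩ := bdry_cls_eq_exp_iff.mp ht''.symm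
  rw [← ht'']
  refine bdry_cls_eq_exp_iff (A := A * B).mpr ⟨r * q, mul_ne_zero hr hq, ?_⟩
  rw [Matrix.SpecialLinearGroup.coe_mul, ← Matrix.mulVec_mulVec, hB, Matrix.mulVec_smul, hA,
    smul_smul]

theorem bdry_congr (x : G) {t t' : ℝ} (h : Circle.exp t = Circle.exp t') :
    bdry x t = bdry x t' := by
  have := bdry_mul (x := x) (y := 1) (t := t) (t' := t') (by rw [bdry_one, h])
  rwa [mul_one] at this

theorem bdry_injective (x : G) {t t' : ℝ} (h : bdry x t = bdry x t') :
    Circle.exp t = Circle.exp t' := by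
  obtain ⟨s, hs⟩ := Circle.exp_surjective (bdry x t)
  have h1 := bdry_mul (x := x⁻¹) hs.symm
  have h2 := bdry_mul (x := x⁻¹) (h ▸ hs.symm)
  rw [inv_mul_cancel, bdry_one] at h1 h2
  rw [h1, h2]

theorem continuous_bdry : Continuous fun p : G × ℝ => bdry p.1 p.2 := by
  -- Openness of `cls` is what keeps the product with the identity a quotient map, so that joint
  -- continuity may be tested on matrices.
  have hq : IsOpenQuotientMap (Prod.map cls (id : ℝ → ℝ)) :=
    (QuotientGroup.isOpenQuotientMap_mk).prodMap IsOpenQuotientMap.id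
  rw [← hq.continuous_comp_iff]
  have hc : Continuous fun p : SL(2, ℝ) × ℝ => toComplex (p.1.val.mulVec (vec p.2)) :=
    continuous_toComplex.comp
      ((continuous_subtype_val.comp continuous_fst).matrix_mulVec
        (continuous_vec.comp continuous_snd))
  refine Continuous.subtype_mk ?_ _
  exact (Complex.continuous_conj.comp hc).div hc
    fun p => toComplex_ne_zero (mulVec_ne_zero p.1 (vec_ne_zero p.2))

theorem continuous_bdry_comp {X : Type*} [TopologicalSpace X] {f : X → G} {g : X → ℝ}
    (hf : Continuous f) (hg : Continuous g) : Continuous fun x => bdry (f x) (g x) := by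
  have h : Continuous fun x => (f x, g x) := hf.prodMk hg
  have := continuous_bdry.comp h
  exact this

/-! ### Lifting paths of `G` to the line -/

theorem PathGroup.apply_zero (γ : PathGroup G) : (γ : C(I, G)) 0 = 1 := γ.2

/-- For a path `γ` in `G` starting at `1`, the lift to `ℝ` of the isotopy of the boundary circle
given by `γ`. -/
def lineLift (γ : PathGroup G) : C(I × ℝ, ℝ) :=
  Circle.isCoveringMap_exp.liftHomotopy
    ⟨fun p => bdry ((γ : C(I, G)) p.1) p.2, continuous_bdry_comp (by fun_prop) (by fun_prop)⟩
    (ContinuousMap.id ℝ)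
    (fun t => by simp [PathGroup.apply_zero, bdry_one])

theorem exp_lineLift (γ : PathGroup G) (s : I) (t : ℝ) :
    Circle.exp (lineLift γ (s, t)) = bdry ((γ : C(I, G)) s) t :=
  congrFun (Circle.isCoveringMap_exp.liftHomotopy_lifts _ _ _) (s, t)

theorem lineLift_zero (γ : PathGroup G) (t : ℝ) : lineLift γ (0, t) = t :=
  Circle.isCoveringMap_exp.liftHomotopy_zero _ _ _ t

/-- Uniqueness of path lifting; the later formulas for `lineLift` come from exhibiting a continuous
candidate with the right start and projection. -/
theorem eq_lineLift {γ : PathGroup G} {t : ℝ} {f : I → ℝ} (hf : Continuous f) (h0 : f 0 = t)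
    (h : ∀ s, Circle.exp (f s) = bdry ((γ : C(I, G)) s) t) (s : I) : f s = lineLift γ (s, t) := by
  have := Circle.isCoveringMap_exp.eq_of_comp_eq hf
    ((lineLift γ).continuous.comp (by fun_prop : Continuous fun s : I => (s, t)))
    (by ext s; simp [exp_lineLift, h]) 0 (by simp [h0, lineLift_zero])
  exact congrFun this s

theorem lineLift_add (γ : PathGroup G) (s : I) (t : ℝ) (k : ℤ) :
    lineLift γ (s, t + 2 * Real.pi * k) = lineLift γ (s, t) + 2 * Real.pi * k := by
  have he : ∀ r : ℝ, Circle.exp (r + 2 * Real.pi * k) = Circle.exp r := fun r => by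
    rw [Circle.exp_add, Circle.exp_two_pi_mul_int, mul_one]
  refine (eq_lineLift (f := fun s => lineLift γ (s, t) + 2 * Real.pi * k) (by fun_prop)
    (by simp [lineLift_zero]) (fun s => ?_) s).symm
  rw [he, exp_lineLift, bdry_congr _ (he t)]

theorem exp_eq_exp_iff {t t' : ℝ} :
    Circle.exp t = Circle.exp t' ↔ ∃ k : ℤ, t = t' + 2 * Real.pi * k := by
  simp only [Circle.exp_eq_exp, mul_comm]

/-- Points with equal images differ by a multiple of `2π`, which equivariance forces to be `0`. A
continuous injective map of the line is monotone, and commuting with translation by `2π` excludes a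
decreasing one. -/
theorem strictMono_lineLift (γ : PathGroup G) (s : I) : StrictMono fun t => lineLift γ (s, t) := by
  have hinj : Function.Injective fun t => lineLift γ (s, t) := by
    intro t t' h
    have h : lineLift γ (s, t) = lineLift γ (s, t') := h
    have h1 := congrArg Circle.exp h
    rw [exp_lineLift, exp_lineLift] at h1
    obtain ⟨k, rfl⟩ := exp_eq_exp_iff.mp (bdry_injective _ h1)
    rw [lineLift_add] at h
    linarith
  refine (Continuous.strictMono_of_inj (by fun_prop) hinj).resolve_right fun hanti => ?_
  have h1 := hanti (show (0 : ℝ) < 0 + 2 * Real.pi * (1 : ℤ) by simp [Real.pi_pos])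
  simp only [lineLift_add] at h1
  push_cast at h1
  linarith [Real.pi_pos]

theorem lineLift_mul (γ δ : PathGroup G) (s : I) (t : ℝ) :
    lineLift (γ * δ) (s, t) = lineLift γ (s, lineLift δ (s, t)) := by
  refine (eq_lineLift (f := fun s => lineLift γ (s, lineLift δ (s, t))) (by fun_prop)
    (by simp [lineLift_zero]) (fun s => ?_) s).symm
  rw [exp_lineLift]
  exact (bdry_mul (exp_lineLift δ s t).symm).symm

/-- A contraction of the loop moves the orbit path of a boundary point by a homotopy relative to the
end points, and lifts of such homotopic paths end at the same point. This makes `act` well defined.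
-/
theorem lineLift_of_mem_nullLoops {γ : PathGroup G} (h : γ ∈ NullLoops G) (t : ℝ) :
    lineLift γ (1, t) = t := by
  have hc : Continuous fun x : G => bdry x t :=
    continuous_bdry_comp continuous_id continuous_const
  have h1 : (ContinuousMap.comp ⟨_, hc⟩ (γ : C(I, G))).HomotopicRel
      (ContinuousMap.comp ⟨_, hc⟩ (1 : C(I, G))) {0, 1} := by
    obtain ⟨F⟩ := h
    exact ⟨F.compContinuousMap ⟨_, hc⟩⟩
  have h2 := Circle.isCoveringMap_exp.liftPath_apply_one_eq_of_homotopicRel h1 t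
    (by simp [PathGroup.apply_zero, bdry_one]) (by simp [bdry_one])
  have h3 := eq_lineLift (γ := γ) (ContinuousMap.continuous _)
    (Circle.isCoveringMap_exp.liftPath_zero (ContinuousMap.comp ⟨_, hc⟩ (γ : C(I, G))) t
      (by simp [PathGroup.apply_zero, bdry_one]))
    (fun s => congrFun (Circle.isCoveringMap_exp.liftPath_lifts
      (ContinuousMap.comp ⟨_, hc⟩ (γ : C(I, G))) t
      (by simp [PathGroup.apply_zero, bdry_one])) s)
  have h4 := (Circle.isCoveringMap_exp.eq_liftPath_iff (Γ := fun _ => t)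
    (γ := ContinuousMap.comp ⟨_, hc⟩ (1 : C(I, G))) (e := t) (by simp [bdry_one])).mpr
    ⟨continuous_const, by ext s; simp [bdry_one], rfl⟩
  rw [← h3 1, h2, ← h4]

/-! ### The action of the universal cover on the line -/

/-- The action of `G̃` on the universal cover of the boundary circle. -/
def act (x : Gtilde) (t : ℝ) : ℝ :=
  Quotient.liftOn' x (fun γ => lineLift γ (1, t)) (by
    intro γ δ h
    have h1 : γ⁻¹ * δ ∈ NullLoops G := QuotientGroup.leftRel_apply.mp h
    have h2 : lineLift (γ * (γ⁻¹ * δ)) (1, t) = lineLift γ (1, t) := by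
      rw [lineLift_mul, lineLift_of_mem_nullLoops h1]
    simpa using h2.symm)

theorem act_mk (γ : PathGroup G) (t : ℝ) :
    act (QuotientGroup.mk γ) t = lineLift γ (1, t) := rfl

theorem act_mul (x y : Gtilde) (t : ℝ) : act (x * y) t = act x (act y t) := by
  induction x using QuotientGroup.induction_on with | H γ =>
  induction y using QuotientGroup.induction_on with | H δ =>
  exact lineLift_mul γ δ 1 t

theorem act_one (t : ℝ) : act 1 t = t := lineLift_of_mem_nullLoops (one_mem _) t

theorem act_inv_act (x : Gtilde) (t : ℝ) : act x⁻¹ (act x t) = t := by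
  rw [← act_mul, inv_mul_cancel, act_one]

theorem act_add (x : Gtilde) (t : ℝ) (k : ℤ) :
    act x (t + 2 * Real.pi * k) = act x t + 2 * Real.pi * k := by
  induction x using QuotientGroup.induction_on with | H γ =>
  exact lineLift_add γ 1 t k

theorem strictMono_act (x : Gtilde) : StrictMono (act x) := by
  induction x using QuotientGroup.induction_on with | H γ =>
  exact strictMono_lineLift γ 1

theorem exp_act (x : Gtilde) (t : ℝ) :
    Circle.exp (act x t) = bdry (UniversalCover.proj G x) t := by
  induction x using QuotientGroup.induction_on with | H γ =>
  exact exp_lineLift γ 1 t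

theorem rotMatrix_mulVec_vec (φ t : ℝ) : (rotMatrix φ).val.mulVec (vec t) = vec (t + φ) := by
  have h : (t + φ) / 2 = t / 2 + φ / 2 := by ring
  ext i
  fin_cases i <;> simp [rotMatrix, vec, Matrix.mulVec, dotProduct, h, Real.cos_add, Real.sin_add] <;>
    ring

theorem act_u (t : ℝ) : act u t = t + 2 * Real.pi := by
  have := eq_lineLift (γ := fullTurn) (t := t) (f := fun s => t + 2 * Real.pi * s) (by fun_prop)
    (by simp) (fun s => (bdry_cls_eq_exp_iff.mpr
      ⟨1, one_ne_zero, by rw [rotMatrix_mulVec_vec, one_smul]⟩).symm) 1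
  rw [u, act_mk, ← this]
  simp

theorem act_u_zpow (k : ℤ) (t : ℝ) : act (u ^ k) t = t + 2 * Real.pi * k := by
  have hn : ∀ (n : ℕ) (t : ℝ), act (u ^ n) t = t + 2 * Real.pi * n := by
    intro n
    induction n with
    | zero => intro t; simp [act_one]
    | succ n ih => intro t; rw [pow_succ, act_mul, act_u, ih]; push_cast; ring
  obtain ⟨n, rfl | rfl⟩ := k.eq_nat_or_neg
  · rw [zpow_natCast, hn]; simp
  · have h := act_inv_act (u ^ n) (t - 2 * Real.pi * n)
    rw [hn, sub_add_cancel] at h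
    rw [zpow_neg, zpow_natCast, h]
    push_cast
    ring

/-! ### The kernel of the covering homomorphism -/

theorem cls_eq_of_val_eq_neg {A B : SL(2, ℝ)} (h : B.val = -A.val) : cls A = cls B := by
  refine QuotientGroup.eq.mpr (Matrix.SpecialLinearGroup.mem_center_iff.mpr ⟨-1, by simp, ?_⟩)
  rw [Matrix.SpecialLinearGroup.coe_mul, h, mul_neg, ← Matrix.SpecialLinearGroup.coe_mul,
    inv_mul_cancel, map_neg, map_one]
  rfl

/-! ### Iwasawa coordinates on `G` and contraction of loops -/

theorem continuous_of_comp_cls {X : Type*} [TopologicalSpace X] {f : G → X}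
    (h : Continuous fun A => f (cls A)) : Continuous f := by
  have hq : IsOpenQuotientMap cls := QuotientGroup.isOpenQuotientMap_mk
  exact hq.continuous_comp_iff.mp h

/-- The logarithm of the length of the first column of a representative. -/
def logLength (x : G) : ℝ :=
  Quotient.liftOn' x (fun A : SL(2, ℝ) => Real.log √(A.val 0 0 ^ 2 + A.val 1 0 ^ 2)) (by
    intro A B hAB
    have h : cls A = cls B := Quotient.sound' hAB
    rcases val_eq_or_of_cls_eq h with h | h <;> simp [h])

theorem logLength_cls (A : SL(2, ℝ)) :
    logLength (cls A) = Real.log √(A.val 0 0 ^ 2 + A.val 1 0 ^ 2) := rfl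

/-- The scalar product of the columns of a representative, divided by the length of the first. -/
def shear (x : G) : ℝ :=
  Quotient.liftOn' x (fun A : SL(2, ℝ) =>
    (A.val 0 0 * A.val 0 1 + A.val 1 0 * A.val 1 1) / √(A.val 0 0 ^ 2 + A.val 1 0 ^ 2)) (by
    intro A B hAB
    have h : cls A = cls B := Quotient.sound' hAB
    rcases val_eq_or_of_cls_eq h with h | h <;> simp [h])

theorem shear_cls (A : SL(2, ℝ)) : shear (cls A) =
    (A.val 0 0 * A.val 0 1 + A.val 1 0 * A.val 1 1) / √(A.val 0 0 ^ 2 + A.val 1 0 ^ 2) := rfl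

theorem det_eq_one (A : SL(2, ℝ)) :
    A.val 0 0 * A.val 1 1 - A.val 0 1 * A.val 1 0 = 1 := by
  rw [← Matrix.det_fin_two]
  exact A.2

theorem length_pos (A : SL(2, ℝ)) : 0 < √(A.val 0 0 ^ 2 + A.val 1 0 ^ 2) := by
  refine Real.sqrt_pos.mpr ?_
  have h := det_eq_one A
  by_contra hn
  have h0 : A.val 0 0 = 0 := by nlinarith [sq_nonneg (A.val 0 0), sq_nonneg (A.val 1 0)]
  have h1 : A.val 1 0 = 0 := by nlinarith [sq_nonneg (A.val 0 0), sq_nonneg (A.val 1 0)]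
  simp [h0, h1] at h

theorem continuous_entry (i j : Fin 2) : Continuous fun A : SL(2, ℝ) => A.val i j :=
  (continuous_apply_apply i j).comp continuous_subtype_val

theorem continuous_logLength : Continuous logLength := by
  refine continuous_of_comp_cls ?_
  simp only [logLength_cls]
  refine Continuous.log (Real.continuous_sqrt.comp
    (((continuous_entry 0 0).pow 2).add ((continuous_entry 1 0).pow 2))) fun A => ?_
  exact (length_pos A).ne'

theorem continuous_shear : Continuous shear := by
  refine continuous_of_comp_cls ?_
  simp only [shear_cls]
  refine Continuous.div (((continuous_entry 0 0).mul (continuous_entry 0 1)).add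
    ((continuous_entry 1 0).mul (continuous_entry 1 1))) (Real.continuous_sqrt.comp
    (((continuous_entry 0 0).pow 2).add ((continuous_entry 1 0).pow 2))) fun A => ?_
  exact (length_pos A).ne'

/-- The upper triangular matrix with diagonal `exp l`, `exp (-l)` and corner `b`. -/
def upper (l b : ℝ) : SL(2, ℝ) :=
  ⟨!![Real.exp l, b; 0, Real.exp (-l)], by
    rw [Matrix.det_fin_two_of, ← Real.exp_add]
    simp⟩

/-- A rotation times an upper triangular matrix. -/
def kan (θ l b : ℝ) : SL(2, ℝ) := rotMatrix θ * upper l b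

theorem continuous_kan {X : Type*} [TopologicalSpace X] {θ l b : X → ℝ} (hθ : Continuous θ)
    (hl : Continuous l) (hb : Continuous b) : Continuous fun x => kan (θ x) (l x) (b x) := by
  refine (continuous_rotMatrix.comp hθ).mul (Continuous.subtype_mk (continuous_matrix ?_) _)
  intro i j
  fin_cases i <;> fin_cases j <;> simp <;> fun_prop

theorem val_kan (θ l b : ℝ) : (kan θ l b).val =
    !![Real.cos (θ / 2) * Real.exp l, Real.cos (θ / 2) * b + Real.sin (θ / 2) * Real.exp (-l);
      -Real.sin (θ / 2) * Real.exp l, -Real.sin (θ / 2) * b + Real.cos (θ / 2) * Real.exp (-l)] := by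
  rw [kan, Matrix.SpecialLinearGroup.coe_mul, rotMatrix, upper, Matrix.mul_fin_two]
  simp

theorem kan_zero : kan 0 0 0 = 1 := by
  ext i j
  fin_cases i <;> fin_cases j <;> simp [val_kan]

theorem cls_one : cls 1 = 1 := rfl

theorem logLength_one : logLength 1 = 0 := by
  rw [← cls_one, logLength_cls]; simp

theorem shear_one : shear 1 = 0 := by
  rw [← cls_one, shear_cls]; simp

/-- Orthonormalisation of the columns: `r` is the length of the first column, `θ` gives its
direction, and the determinant condition fixes the remaining diagonal entry as `1 / r`. -/
theorem cls_kan_of_mulVec {A : SL(2, ℝ)} {r θ : ℝ} (hr : 0 < r)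
    (h : A.val.mulVec (vec 0) = r • vec θ) :
    cls (kan θ (logLength (cls A)) (shear (cls A))) = cls A := by
  have h0 : A.val 0 0 = r * Real.cos (θ / 2) := by
    simpa [Matrix.mulVec, dotProduct, vec] using congrFun h 0
  have h1 : A.val 1 0 = -(r * Real.sin (θ / 2)) := by
    simpa [Matrix.mulVec, dotProduct, vec] using congrFun h 1
  have hcs := Real.sin_sq_add_cos_sq (θ / 2)
  have hn : √(A.val 0 0 ^ 2 + A.val 1 0 ^ 2) = r := by
    rw [← Real.sqrt_sq hr.le, h0, h1]
    congr 1
    linear_combination r ^ 2 * hcs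
  have hdet := det_eq_one A
  rw [logLength_cls, shear_cls, hn]
  congr 1
  ext i j
  have hr' := hr.ne'
  rw [h0, h1] at hdet
  fin_cases i <;> fin_cases j <;>
    simp [val_kan, Real.exp_neg, Real.exp_log hr, h0, h1]
  · ring
  · field_simp
    linear_combination r * A.val 0 1 * hcs - Real.sin (θ / 2) * hdet
  · ring
  · field_simp
    linear_combination r * A.val 1 1 * hcs - Real.cos (θ / 2) * hdet

theorem cls_kan {x : G} {θ : ℝ} (h : bdry x 0 = Circle.exp θ) :
    cls (kan θ (logLength x) (shear x)) = x := by
  obtain ⟨A, rfl⟩ := cls_surjective x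
  obtain ⟨r, hr, hA⟩ := bdry_cls_eq_exp_iff.mp h
  rcases hr.lt_or_gt with hr | hr
  · have hB : cls A = cls (-A) := cls_eq_of_val_eq_neg (by simp)
    rw [hB]
    refine cls_kan_of_mulVec (r := -r) (by linarith) ?_
    rw [neg_smul, ← hA, ← Matrix.neg_mulVec]
    simp
  · exact cls_kan_of_mulVec hr hA

/-- Length and shear are global real coordinates on `G`, while the angle becomes real along a path
through `lineLift`. Scaling all three by `1 - τ` contracts the path. The end point stays at `1`
because the lifted angle ends at `0` and not merely at a multiple of `2π`. -/
theorem mem_nullLoops {γ : PathGroup G} (h1 : (γ : C(I, G)) 1 = 1) (h : lineLift γ (1, 0) = 0) :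
    γ ∈ NullLoops G := by
  have hγ : ∀ s, cls (kan (lineLift γ (s, 0)) (logLength ((γ : C(I, G)) s))
      (shear ((γ : C(I, G)) s))) = (γ : C(I, G)) s :=
    fun s => cls_kan (exp_lineLift γ s 0).symm
  have hl : Continuous fun s : I => logLength ((γ : C(I, G)) s) :=
    continuous_logLength.comp (ContinuousMap.continuous _)
  have hb : Continuous fun s : I => shear ((γ : C(I, G)) s) :=
    continuous_shear.comp (ContinuousMap.continuous _)
  have hθ : Continuous fun s : I => lineLift γ (s, 0) := by fun_prop
  have hτ : Continuous fun p : I × I => 1 - (p.1 : ℝ) := by fun_prop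
  refine ⟨⟨⟨⟨fun p => cls (kan ((1 - (p.1 : ℝ)) * lineLift γ (p.2, 0))
      ((1 - (p.1 : ℝ)) * logLength ((γ : C(I, G)) p.2))
      ((1 - (p.1 : ℝ)) * shear ((γ : C(I, G)) p.2))), ?_⟩, ?_, ?_⟩, ?_⟩⟩
  · exact continuous_cls.comp (continuous_kan (hτ.mul (hθ.comp continuous_snd))
      (hτ.mul (hl.comp continuous_snd)) (hτ.mul (hb.comp continuous_snd)))
  · intro s
    simp [hγ]
  · intro s
    simp [kan_zero, cls_one]
  · intro τ s hs
    rcases hs with rfl | rfl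
    · simp [PathGroup.apply_zero, lineLift_zero, logLength_one, shear_one, kan_zero, cls_one]
    · simp [h1, h, logLength_one, shear_one, kan_zero, cls_one]

theorem proj_mk (γ : PathGroup G) :
    UniversalCover.proj G (QuotientGroup.mk γ) = (γ : C(I, G)) 1 := rfl

theorem proj_u : UniversalCover.proj G u = 1 := by
  rw [u, proj_mk]
  change cls (rotMatrix (2 * Real.pi * ((1 : I) : ℝ))) = 1
  rw [← cls_one]
  refine (cls_eq_of_val_eq_neg ?_).symm
  ext i j
  fin_cases i <;> fin_cases j <;> simp [rotMatrix]

theorem proj_u_zpow (k : ℤ) : UniversalCover.proj G (u ^ k) = 1 := by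
  rw [map_zpow, proj_u, one_zpow]

theorem eq_one_of_proj_of_act {x : Gtilde} (h : UniversalCover.proj G x = 1) (h0 : act x 0 = 0) :
    x = 1 := by
  induction x using QuotientGroup.induction_on with | H γ =>
  exact (QuotientGroup.eq_one_iff γ).mpr (mem_nullLoops h h0)

theorem exists_eq_u_zpow {x : Gtilde} (h : UniversalCover.proj G x = 1) : ∃ k : ℤ, x = u ^ k := by
  have h1 := exp_act x 0
  rw [h, bdry_one] at h1
  obtain ⟨k, hk⟩ := exp_eq_exp_iff.mp h1
  refine ⟨k, ?_⟩
  have h2 : u ^ (-k) * x = 1 := by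
    refine eq_one_of_proj_of_act (by rw [map_mul, h, proj_u_zpow, mul_one]) ?_
    rw [act_mul, act_u_zpow, hk]
    push_cast
    ring
  rw [zpow_neg, inv_mul_eq_one] at h2
  exact h2.symm

theorem u_zpow_injective : Function.Injective fun k : ℤ => u ^ k := by
  intro j k h
  have h1 := congrArg (fun x => act x 0) h
  simp only [act_u_zpow] at h1
  have h2 : (j : ℝ) = k := by
    have := Real.pi_pos
    have h3 : 2 * Real.pi * ((j : ℝ) - k) = 0 := by linarith
    rcases mul_eq_zero.mp h3 with h4 | h4 <;> linarith
  exact_mod_cast h2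

theorem proj_surjective : Function.Surjective (UniversalCover.proj G) := by
  intro x
  obtain ⟨θ, hθ⟩ := Circle.exp_surjective (bdry x 0)
  have hx := cls_kan hθ.symm
  obtain ⟨y, hy⟩ := cls_mem_range (fun s => kan (s * θ) (s * logLength x) (s * shear x))
    (continuous_kan (by fun_prop) (by fun_prop) (by fun_prop)) (by simp [kan_zero])
  exact ⟨y, by simpa [hx] using hy⟩

theorem mk_eq_mk_of_homotopicRel {γ δ : PathGroup G}
    (h : (γ : C(I, G)).HomotopicRel (δ : C(I, G)) {0, 1}) :
    (QuotientGroup.mk γ : Gtilde) = QuotientGroup.mk δ := by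
  refine QuotientGroup.eq.mpr ?_
  have := homotopicRel_mul
    (ContinuousMap.HomotopicRel.refl (S := {0, 1}) ((γ : C(I, G))⁻¹)) h
  rw [inv_mul_cancel] at this
  exact this.symm

theorem u_mem_center : u ∈ Subgroup.center Gtilde := by
  refine Subgroup.mem_center_iff.mpr fun x => ?_
  induction x using QuotientGroup.induction_on with | H γ =>
  have hu1 : (fullTurn : C(I, G)) 1 = 1 := proj_u
  suffices h : (QuotientGroup.mk fullTurn : Gtilde) = QuotientGroup.mk (γ * fullTurn * γ⁻¹) by
    have h2 : u = QuotientGroup.mk γ * u * (QuotientGroup.mk γ)⁻¹ := h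
    exact (eq_mul_inv_iff_mul_eq.mp h2).symm
  -- The loop is conjugated by `γ (τ s)`, which at `τ = 0` is `1` and at `τ = 1` is `γ s`. At `s =
  -- 1` the conjugated element is `1`, so the end points do not move.
  refine mk_eq_mk_of_homotopicRel ⟨⟨⟨⟨fun p => (γ : C(I, G)) (p.1 * p.2) *
    (fullTurn : C(I, G)) p.2 * ((γ : C(I, G)) (p.1 * p.2))⁻¹, ?_⟩, ?_, ?_⟩, ?_⟩⟩
  · fun_prop
  · intro s
    simp [PathGroup.apply_zero]
  · intro s
    simp
  · intro τ s hs
    rcases hs with rfl | rfl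
    · simp [PathGroup.apply_zero]
    · simp [hu1]

theorem u_zpow_mul_comm (k : ℤ) (x : Gtilde) : u ^ k * x = x * u ^ k :=
  (Subgroup.mem_center_iff.mp (zpow_mem u_mem_center k) x).symm

theorem u_zpow_mem_mCenter_iff {m : ℕ} {k : ℤ} : u ^ k ∈ mCenter m ↔ (m : ℤ) ∣ k := by
  constructor
  · rintro ⟨z, hz, h⟩
    obtain ⟨j, rfl⟩ := exists_eq_u_zpow (center_le_ker hz)
    rw [← zpow_natCast, ← zpow_mul] at h
    exact ⟨j, by rw [mul_comm]; exact (u_zpow_injective h).symm⟩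
  · rintro ⟨j, rfl⟩
    exact ⟨u ^ j, zpow_mem u_mem_center j, by rw [← zpow_natCast, ← zpow_mul, mul_comm]⟩

/-! ### Levels as displacements of lifted fixed points -/

/-- A strictly increasing map of the line that commutes with the translation by `2π` has only one
integral displacement. -/
theorem displacement_unique {f : ℝ → ℝ} (hf : StrictMono f)
    (hadd : ∀ (t : ℝ) (k : ℤ), f (t + 2 * Real.pi * k) = f t + 2 * Real.pi * k)
    {t t' : ℝ} {j k : ℤ} (h : f t = t + 2 * Real.pi * j) (h' : f t' = t' + 2 * Real.pi * k) :
    j = k := by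
  have hp : 0 < 2 * Real.pi := by linarith [Real.pi_pos]
  -- Translate `t'` into `[t, t + 2π)`. Monotonicity then keeps the two displacements less than one
  -- full turn apart.
  obtain ⟨n, ⟨h1, h2⟩, -⟩ := existsUnique_add_zsmul_mem_Ico hp t' t
  have h1 : t ≤ t' + 2 * Real.pi * n := by simpa [mul_comm] using h1
  have h2 : t' + 2 * Real.pi * n < t + 2 * Real.pi * (1 : ℤ) := by simpa [mul_comm] using h2
  have h3 := hf.monotone h1
  have h4 := hf h2
  rw [hadd, h'] at h3 h4
  rw [h] at h3
  rw [hadd, h] at h4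
  push_cast at h2 h4
  have h5 : (j : ℝ) - k < 1 := by
    by_contra hc
    nlinarith
  have h6 : (k : ℝ) - j < 1 := by
    by_contra hc
    nlinarith
  have h5' : j - k < 1 := by exact_mod_cast h5
  have h6' : k - j < 1 := by exact_mod_cast h6
  omega

/-- Some boundary point, lifted to the line, is displaced by `x` through `k` full turns. -/
def HasLevel (x : Gtilde) (k : ℤ) : Prop := ∃ t : ℝ, act x t = t + 2 * Real.pi * k

theorem HasLevel.unique {x : Gtilde} {j k : ℤ} (hj : HasLevel x j) (hk : HasLevel x k) :
    j = k := by
  obtain ⟨t, ht⟩ := hj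
  obtain ⟨t', ht'⟩ := hk
  exact displacement_unique (strictMono_act x) (act_add x) ht ht'

theorem HasLevel.act_eq {x : Gtilde} {k : ℤ} (hk : HasLevel x k) {t : ℝ}
    (ht : bdry (UniversalCover.proj G x) t = Circle.exp t) : act x t = t + 2 * Real.pi * k := by
  rw [← exp_act] at ht
  obtain ⟨j, hj⟩ := exp_eq_exp_iff.mp ht
  rw [hj, HasLevel.unique ⟨t, hj⟩ hk]

theorem HasLevel.mul_u_zpow {x : Gtilde} {k : ℤ} (hk : HasLevel x k) (j : ℤ) :
    HasLevel (x * u ^ j) (k + j) := by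
  obtain ⟨t, ht⟩ := hk
  refine ⟨t, ?_⟩
  rw [act_mul, act_u_zpow, act_add, ht]
  push_cast
  ring

theorem HasLevel.inv {x : Gtilde} {k : ℤ} (hk : HasLevel x k) : HasLevel x⁻¹ (-k) := by
  obtain ⟨t, ht⟩ := hk
  refine ⟨act x t, ?_⟩
  rw [act_inv_act, ht]
  push_cast
  ring

theorem HasLevel.conj {x : Gtilde} {k : ℤ} (hk : HasLevel x k) (y : Gtilde) :
    HasLevel (y * x * y⁻¹) k := by
  obtain ⟨t, ht⟩ := hk
  refine ⟨act y t, ?_⟩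
  rw [act_mul, act_inv_act, act_mul, ht, act_add]

/-! ### The set `Ξ` -/

theorem discr_eq (A : SL(2, ℝ)) : A.val.discr = (A.val 0 0 + A.val 1 1) ^ 2 - 4 := by
  rw [Matrix.discr_fin_two, Matrix.trace_fin_two, A.2]
  ring

theorem exists_two_le_trace {A : SL(2, ℝ)} (h : 0 ≤ A.val.discr) :
    ∃ B : SL(2, ℝ), cls B = cls A ∧ 2 ≤ B.val 0 0 + B.val 1 1 := by
  rw [discr_eq] at h
  rcases le_total 0 (A.val 0 0 + A.val 1 1) with h0 | h0
  · exact ⟨A, rfl, by nlinarith⟩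
  · refine ⟨-A, (cls_eq_of_val_eq_neg (by simp)).symm, ?_⟩
    simp only [Matrix.SpecialLinearGroup.coe_neg, Matrix.neg_apply]
    nlinarith

/-- Choosing the sign of the representative turns the three kinds of elements into one closed
condition on the trace; at trace `2` a scalar matrix gives the identity and any other a parabolic
element. -/
theorem mem_Xi_iff {x : G} : x ∈ Xi ↔ ∃ A : SL(2, ℝ), cls A = x ∧ 2 ≤ A.val 0 0 + A.val 1 1 := by
  constructor
  · rintro (⟨A, rfl, h⟩ | ⟨A, rfl, h⟩ | rfl)
    · exact exists_two_le_trace (le_of_lt h)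
    · exact exists_two_le_trace h.2.ge
    · exact ⟨1, rfl, by norm_num⟩
  · rintro ⟨A, rfl, h⟩
    have hd : 0 ≤ A.val.discr := by rw [discr_eq]; nlinarith
    rcases hd.lt_or_eq with hd | hd
    · exact Or.inl ⟨A, rfl, hd⟩
    · refine Or.inr ?_
      by_cases hs : A.val ∈ Set.range (Matrix.scalar (Fin 2))
      · right
        obtain ⟨r, hr⟩ := hs
        refine (QuotientGroup.eq_one_iff A).mpr
          (Matrix.SpecialLinearGroup.mem_center_iff.mpr ⟨r, ?_, hr⟩)
        have := det_eq_one A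
        rw [← hr] at this
        simpa [sq] using this
      · exact Or.inl ⟨A, rfl, hs, hd.symm⟩

theorem exists_bdry_fixed {x : G} (hx : x ∈ Xi) : ∃ t : ℝ, bdry x t = Circle.exp t := by
  obtain ⟨A, rfl, h⟩ := mem_Xi_iff.mp hx
  have hdet := det_eq_one A
  obtain ⟨v, hv, l, hl⟩ : ∃ v : Fin 2 → ℝ, v ≠ 0 ∧ ∃ l : ℝ, A.val.mulVec v = l • v := by
    by_cases hc : A.val 1 0 = 0
    · refine ⟨![1, 0], fun h0 => by simpa using congrFun h0 0, A.val 0 0, ?_⟩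
      ext i
      fin_cases i <;> simp [Matrix.mulVec, dotProduct, hc]
    · set T := A.val 0 0 + A.val 1 1 with hT
      have hs : √(T ^ 2 - 4) ^ 2 = T ^ 2 - 4 := Real.sq_sqrt (by nlinarith)
      set q := √(T ^ 2 - 4)
      -- The eigenvector for the larger eigenvalue, read off from the second row; the first row is
      -- then the characteristic equation.
      refine ⟨![(T + q) / 2 - A.val 1 1, A.val 1 0], fun h0 => hc (by simpa using congrFun h0 1),
        (T + q) / 2, ?_⟩
      ext i
      fin_cases i <;> simp [Matrix.mulVec, dotProduct]
      · rw [hT] at hs ⊢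
        linear_combination -hdet - hs / 4
      · ring
  obtain ⟨t, ht⟩ := Circle.exp_surjective (linePt v hv)
  obtain ⟨r, hr, hvr⟩ := exists_smul_vec_of_linePt hv ht.symm
  refine ⟨t, bdry_cls_eq_exp_iff.mpr ⟨l, ?_, ?_⟩⟩
  · rintro rfl
    exact mulVec_ne_zero A hv (by simpa using hl)
  · rw [hvr, Matrix.mulVec_smul, smul_comm] at hl
    exact smul_right_injective _ hr hl

/-- The times at which the lifted isotopy has a fixed point form a clopen set containing `0`, so
they fill the interval. Equivariance confines the search for points to the compact period `[0, 2π]`,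
which makes such sets of times closed. -/
theorem exists_lineLift_fixed {γ : PathGroup G} (hγ : ∀ s : I, (γ : C(I, G)) s ∈ Xi) :
    ∃ t : ℝ, lineLift γ (1, t) = t := by
  have hp : 0 < 2 * Real.pi := by linarith [Real.pi_pos]
  have hclosed : ∀ E : Set ℝ, IsClosed E →
      IsClosed {s : I | ∃ t ∈ Set.Icc 0 (2 * Real.pi), lineLift γ (s, t) - t ∈ E} := by
    intro E hE
    have hK : IsCompact ((fun p : I × ℝ => lineLift γ p - p.2) ⁻¹' E ∩
        (Set.univ ×ˢ Set.Icc 0 (2 * Real.pi))) :=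
      (isCompact_univ.prod isCompact_Icc).inter_left (hE.preimage (by fun_prop))
    convert (hK.image continuous_fst).isClosed using 1
    ext s
    constructor
    · rintro ⟨t, ht, h⟩
      exact ⟨(s, t), ⟨h, ⟨trivial, ht⟩⟩, rfl⟩
    · rintro ⟨⟨s', t⟩, ⟨h, ⟨-, ht⟩⟩, rfl⟩
      exact ⟨t, ht, h⟩
  have h0 := hclosed {0} isClosed_singleton
  have h1 := hclosed {r | Circle.exp r = 1 ∧ 2 * Real.pi ≤ |r|}
    ((isClosed_eq Circle.exp.continuous continuous_const).inter
      (isClosed_le continuous_const continuous_abs))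
  -- At each time some boundary point is fixed, so its lift is displaced by `2πk`. By
  -- `displacement_unique` the cases `k = 0` and `k ≠ 0` exclude each other, and the second is the
  -- closed condition `2π ≤ |r|`.
  have hcompl : {s : I | ∃ t ∈ Set.Icc 0 (2 * Real.pi),
      lineLift γ (s, t) - t ∈ ({0} : Set ℝ)}ᶜ = {s : I | ∃ t ∈ Set.Icc 0 (2 * Real.pi),
      lineLift γ (s, t) - t ∈ {r | Circle.exp r = 1 ∧ 2 * Real.pi ≤ |r|}} := by
    ext s
    constructor
    · intro hs
      obtain ⟨t, ht⟩ := exists_bdry_fixed (hγ s)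
      obtain ⟨n, ⟨hn1, hn2⟩, -⟩ := existsUnique_add_zsmul_mem_Ico hp t 0
      have ht' : t + n • (2 * Real.pi) ∈ Set.Icc 0 (2 * Real.pi) := ⟨hn1, by linarith⟩
      have hfix : Circle.exp (lineLift γ (s, t + n • (2 * Real.pi))) =
          Circle.exp (t + n • (2 * Real.pi)) := by
        have he : t + n • (2 * Real.pi) = t + 2 * Real.pi * n := by simp [mul_comm]
        rw [he, lineLift_add, Circle.exp_add, exp_lineLift, ht, Circle.exp_add]
      obtain ⟨k, hk⟩ := exp_eq_exp_iff.mp hfix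
      refine ⟨_, ht', ?_⟩
      have hk' : lineLift γ (s, t + n • (2 * Real.pi)) - (t + n • (2 * Real.pi)) =
          2 * Real.pi * k := by rw [hk]; ring
      have hk0 : k ≠ 0 := by
        rintro rfl
        exact hs ⟨_, ht', by simpa using hk'⟩
      rw [hk']
      refine ⟨Circle.exp_two_pi_mul_int k, ?_⟩
      rw [abs_mul, abs_of_pos hp]
      have : (1 : ℝ) ≤ |(k : ℝ)| := by exact_mod_cast Int.one_le_abs hk0
      nlinarith
    · rintro ⟨t, -, ht1, ht2⟩ ⟨t', -, ht'⟩
      obtain ⟨k, hk⟩ := Circle.exp_eq_one.mp ht1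
      have h5 : lineLift γ (s, t') - t' = 0 := ht'
      have hk0 := displacement_unique (strictMono_lineLift γ s) (lineLift_add γ s)
        (t := t) (t' := t') (j := k) (k := 0) (by linarith) (by push_cast; linarith)
      rw [hk, hk0] at ht2
      simp at ht2
      linarith
  have hclopen : IsClopen {s : I | ∃ t ∈ Set.Icc 0 (2 * Real.pi),
      lineLift γ (s, t) - t ∈ ({0} : Set ℝ)} := ⟨h0, by rw [← isClosed_compl_iff, hcompl]; exact h1⟩
  have huniv := hclopen.eq_univ ⟨0, 0, ⟨le_rfl, hp.le⟩, by simp [lineLift_zero]⟩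
  obtain ⟨t, -, ht⟩ : (1 : I) ∈ {s : I | ∃ t ∈ Set.Icc 0 (2 * Real.pi),
      lineLift γ (s, t) - t ∈ ({0} : Set ℝ)} := huniv ▸ Set.mem_univ _
  exact ⟨t, sub_eq_zero.mp ht⟩

theorem AtLevel.hasLevel {x : Gtilde} {k : ℤ} (h : AtLevel x k) : HasLevel x k := by
  obtain ⟨γ, hγ, rfl⟩ := h
  obtain ⟨t, ht⟩ := exists_lineLift_fixed hγ
  have h0 : HasLevel (QuotientGroup.mk γ : Gtilde) 0 := ⟨t, by rw [act_mk, ht]; simp⟩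
  simpa using h0.mul_u_zpow k

theorem exists_path_in_Xi {x : G} (hx : x ∈ Xi) :
    ∃ γ : PathGroup G, (∀ s : I, (γ : C(I, G)) s ∈ Xi) ∧ (γ : C(I, G)) 1 = x := by
  obtain ⟨A, rfl, hA⟩ := mem_Xi_iff.mp hx
  have hdet := det_eq_one A
  set T := A.val 0 0 + A.val 1 1 with hT
  -- The determinant of `(1 - s) • 1 + s • A`. The path is this segment divided by `√D`.
  let D : I → ℝ := fun s => (1 - (s : ℝ)) ^ 2 + s * (1 - s) * T + s ^ 2
  have hD : ∀ s, 1 ≤ D s := fun s => by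
    have h0 := s.2.1
    have h1 := s.2.2
    have := mul_nonneg h0 (sub_nonneg.mpr h1)
    simp only [D]
    nlinarith
  have hq : ∀ s, 0 < √(D s) := fun s => Real.sqrt_pos.mpr (by linarith [hD s])
  have hq2 : ∀ s, √(D s) ^ 2 = D s := fun s => Real.sq_sqrt (by linarith [hD s])
  let M : I → Matrix (Fin 2) (Fin 2) ℝ := fun s => (1 / √(D s)) •
    !![(1 - s) + s * A.val 0 0, s * A.val 0 1; s * A.val 1 0, (1 - s) + s * A.val 1 1]
  have hM : ∀ s, (M s).det = 1 := fun s => by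
    have := (hq s).ne'
    simp only [M]
    rw [Matrix.det_smul, Matrix.det_fin_two_of]
    simp only [Fintype.card_fin]
    field_simp
    rw [hq2]
    simp only [D]
    rw [hT]
    linear_combination (s : ℝ) ^ 2 * hdet
  let N : I → SL(2, ℝ) := fun s => ⟨M s, hM s⟩
  have hNc : Continuous N := by
    refine Continuous.subtype_mk (Continuous.smul (?_ : Continuous fun s => 1 / √(D s))
      (continuous_matrix ?_)) _
    · exact Continuous.div continuous_const (by simp only [D]; fun_prop) fun s => (hq s).ne'
    · intro i j
      fin_cases i <;> fin_cases j <;> simp <;> fun_prop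
  have hN0 : N 0 = 1 := by
    ext i j
    fin_cases i <;> fin_cases j <;> simp [N, M, D]
  have hN1 : N 1 = A := by
    ext i j
    fin_cases i <;> fin_cases j <;> simp [N, M, D]
  refine ⟨⟨⟨fun s => cls (N s), continuous_cls.comp hNc⟩, ?_⟩, fun s => ?_, ?_⟩
  · exact congrArg cls hN0
  · refine mem_Xi_iff.mpr ⟨_, rfl, ?_⟩
    have htr : M s 0 0 + M s 1 1 = (2 * (1 - s) + s * T) / √(D s) := by
      simp [M, hT]
      ring
    change 2 ≤ M s 0 0 + M s 1 1
    rw [htr, le_div_iff₀ (hq s)]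
    have h0 := s.2.1
    have h1 := s.2.2
    -- After squaring, the claim is that the squared trace of the segment minus `4 D` is
    -- nonnegative; this difference equals `s² (T² - 4)`.
    refine (pow_le_pow_iff_left₀ (by linarith [hq s]) (by nlinarith) two_ne_zero).mp ?_
    rw [mul_pow, hq2]
    simp only [D]
    nlinarith [mul_nonneg (sq_nonneg (s : ℝ)) (by nlinarith : 0 ≤ T ^ 2 - 4)]
  · exact congrArg cls hN1

theorem exists_atLevel {x : Gtilde} (hx : UniversalCover.proj G x ∈ Xi) : ∃ k, AtLevel x k := by
  obtain ⟨γ, hγ, h1⟩ := exists_path_in_Xi hx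
  obtain ⟨k, hk⟩ := exists_eq_u_zpow (x := (QuotientGroup.mk γ : Gtilde)⁻¹ * x) (by
    rw [map_mul, map_inv, proj_mk, h1, inv_mul_cancel])
  exact ⟨k, γ, hγ, by rw [← hk, mul_inv_cancel_left]⟩

/-- The choice inside `level` is harmless: every admissible value is the displacement of a lifted
fixed point, which is unique. -/
theorem hasLevel_level {x : Gtilde} (hx : UniversalCover.proj G x ∈ Xi) :
    HasLevel x (level x) := by
  have h := exists_atLevel hx
  rw [level, dif_pos h]
  exact h.choose_spec.hasLevel

/-! ### Positive elements and sequential triples -/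

/-- The coordinate in `(0, 2π)` of the real boundary point `α`. -/
def ang (α : ℝ) : ℝ := Real.pi + 2 * Real.arctan α

theorem ang_pos (α : ℝ) : 0 < ang α := by
  have := Real.neg_pi_div_two_lt_arctan α
  rw [ang]; linarith

theorem ang_lt (α : ℝ) : ang α < 2 * Real.pi := by
  have := Real.arctan_lt_pi_div_two α
  rw [ang]; linarith

theorem ang_strictMono : StrictMono ang := fun a b h => by
  have := Real.arctan_strictMono h
  rw [ang, ang]; linarith

theorem vec_ang (α : ℝ) : vec (ang α) = (-Real.cos (Real.arctan α)) • ![α, 1] := by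
  have h : ang α / 2 = Real.arctan α + Real.pi / 2 := by rw [ang]; ring
  have h1 : Real.sin (Real.arctan α) = α * Real.cos (Real.arctan α) := by
    have h2 := Real.tan_arctan α
    rwa [Real.tan_eq_sin_div_cos, div_eq_iff (Real.cos_arctan_pos α).ne'] at h2
  ext i
  fin_cases i
  · simp [vec, h, Real.cos_add_pi_div_two, h1, mul_comm]
  · simp [vec, h, Real.sin_add_pi_div_two]

theorem bdry_cls_eq_exp_ang {A : SL(2, ℝ)} {t α l : ℝ} (hl : l ≠ 0)
    (h : A.val.mulVec (vec t) = l • ![α, 1]) : bdry (cls A) t = Circle.exp (ang α) := by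
  have hc := (Real.cos_arctan_pos α).ne'
  refine bdry_cls_eq_exp_iff.mpr ⟨l / (-Real.cos (Real.arctan α)),
    div_ne_zero hl (neg_ne_zero.mpr hc), ?_⟩
  rw [vec_ang, smul_smul, div_mul_cancel₀ _ (neg_ne_zero.mpr hc), h]

/-- A positive element fixes a real point that lies to the right of the image of `∞`. -/
theorem IsPositive.exists_matrix {x : G} (hx : IsPositive x) : ∃ (A : SL(2, ℝ)) (α l : ℝ),
    cls A = x ∧ 2 ≤ A.val 0 0 + A.val 1 1 ∧ l ≠ 0 ∧
      A.val.mulVec ![α, 1] = l • ![α, 1] ∧ A.val 1 0 ≠ 0 ∧ A.val 0 0 / A.val 1 0 < α := by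
  -- The image of `∞` is `α - (β - α) / (l - 1)` in the hyperbolic case and `α - 1 / l` in the
  -- parabolic case.
  rcases hx with ⟨α, β, l, h, hl, rfl⟩ | ⟨α, l, hl, rfl⟩
  · have h0 : 0 < l := by linarith
    have hq : 0 < √l := Real.sqrt_pos.mpr h0
    have hq2 : √l ^ 2 = l := Real.sq_sqrt h0.le
    have hab : α - β ≠ 0 := sub_ne_zero.mpr h.ne
    have hl1 : l - 1 ≠ 0 := by linarith
    refine ⟨_, α, √l, rfl, ?_, hq.ne', ?_, ?_, ?_⟩
    · have : (1 / ((α - β) * √l)) * (l * α - β) + (1 / ((α - β) * √l)) * (α - l * β) =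
          (l + 1) / √l := by
        field_simp
        ring
      simp only [Matrix.smul_apply, smul_eq_mul, Matrix.of_apply, Matrix.cons_val', Matrix.cons_val_zero,
        Matrix.cons_val_one, Matrix.cons_val_fin_one]
      rw [this, le_div_iff₀ hq]
      nlinarith [sq_nonneg (√l - 1)]
    · ext i
      fin_cases i <;> simp [Matrix.mulVec, dotProduct] <;> field_simp <;> rw [hq2] <;> ring
    · simp [hab, hq.ne', hl1]
    · simp only [Matrix.smul_apply, smul_eq_mul, Matrix.of_apply, Matrix.cons_val', Matrix.cons_val_zero,
        Matrix.cons_val_one, Matrix.cons_val_fin_one]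
      rw [mul_div_mul_left _ _ (one_div_ne_zero (mul_ne_zero hab hq.ne')),
        div_lt_iff₀ (by linarith)]
      nlinarith
  · refine ⟨_, α, 1, rfl, ?_, one_ne_zero, ?_, ?_, ?_⟩
    · simp only [Matrix.of_apply, Matrix.cons_val', Matrix.cons_val_zero,
        Matrix.cons_val_one, Matrix.cons_val_fin_one]
      linarith
    · ext i
      fin_cases i <;> simp [Matrix.mulVec, dotProduct]
      ring
    · simpa using hl.ne'
    · simp only [Matrix.of_apply, Matrix.cons_val', Matrix.cons_val_zero,
        Matrix.cons_val_one, Matrix.cons_val_fin_one]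
      rw [div_neg, neg_lt, lt_div_iff₀ hl]
      linarith

theorem IsPositive.mem_Xi {x : G} (hx : IsPositive x) : x ∈ Xi := by
  obtain ⟨A, -, -, h, h2, -⟩ := hx.exists_matrix
  exact mem_Xi_iff.mpr ⟨A, h, h2⟩

/-- The lift of level `0` of a positive element fixes a lifted real point and moves the lift `0`
of `∞` to the right. -/
theorem HasLevel.act_of_isPositive {x : Gtilde} (h0 : HasLevel x 0)
    (hx : IsPositive (UniversalCover.proj G x)) : 0 < act x 0 ∧
      ∃ α : ℝ, FixesReal (UniversalCover.proj G x) α ∧ act x (ang α) = ang α := by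
  obtain ⟨A, α, l, hA, -, hl, hfix, hc, hlt⟩ := hx.exists_matrix
  have hα : act x (ang α) = ang α := by
    have h1 : bdry (UniversalCover.proj G x) (ang α) = Circle.exp (ang α) := by
      rw [← hA]
      refine bdry_cls_eq_exp_ang (l := -Real.cos (Real.arctan α) * l)
        (mul_ne_zero (neg_ne_zero.mpr (Real.cos_arctan_pos α).ne') hl) ?_
      rw [vec_ang, Matrix.mulVec_smul, hfix, smul_smul]
    simpa using h0.act_eq h1
  have hinf : bdry (UniversalCover.proj G x) 0 = Circle.exp (ang (A.val 0 0 / A.val 1 0)) := by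
    rw [← hA]
    refine bdry_cls_eq_exp_ang hc ?_
    ext i
    fin_cases i <;> simp [Matrix.mulVec, dotProduct, vec]
    field_simp
  rw [← exp_act] at hinf
  obtain ⟨j, hj⟩ := exp_eq_exp_iff.mp hinf
  have h1 := ang_strictMono hlt
  have h2 := ang_pos (A.val 0 0 / A.val 1 0)
  have h3 := ang_lt α
  -- The fixed point `ang α - 2π` lies to the left of `0`, so the image of `0` stays to its right.
  -- This rules out negative `j`.
  have h4 : act x (ang α + 2 * Real.pi * (-1 : ℤ)) < act x 0 :=
    strictMono_act x (by push_cast; linarith)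
  rw [act_add, hα, hj] at h4
  push_cast at h4
  have hj0 : -1 < j := by
    have : (-1 : ℝ) < j := by
      by_contra hn
      nlinarith [Real.pi_pos]
    exact_mod_cast this
  have hj1 : (0 : ℝ) ≤ j := by exact_mod_cast (by omega : 0 ≤ j)
  refine ⟨by rw [hj]; nlinarith [Real.pi_pos], α, ⟨A, hA, ?_⟩, hα⟩
  have e0 := congrFun hfix 0
  have e1 := congrFun hfix 1
  simp [Matrix.mulVec, dotProduct] at e0 e1
  rw [e0, e1]
  ring

theorem mul_eq_u_of_isPositive {x y z : Gtilde} (hx : HasLevel x 0) (hy : HasLevel y 0)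
    (hz : HasLevel z 0) (px : IsPositive (UniversalCover.proj G x))
    (py : IsPositive (UniversalCover.proj G y)) (pz : IsPositive (UniversalCover.proj G z))
    (hxy : FixLT (UniversalCover.proj G x) (UniversalCover.proj G y))
    (hyz : FixLT (UniversalCover.proj G y) (UniversalCover.proj G z))
    (h : UniversalCover.proj G (x * y * z) = 1) : x * y * z = u := by
  obtain ⟨x0, α, fα, hα⟩ := hx.act_of_isPositive px
  obtain ⟨y0, β, fβ, hβ⟩ := hy.act_of_isPositive py
  obtain ⟨z0, δ, fδ, hδ⟩ := hz.act_of_isPositive pz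
  have hαδ := ang_strictMono ((hxy α β fα fβ).trans (hyz β δ fβ fδ))
  obtain ⟨k, hk⟩ := exists_eq_u_zpow h
  have hlow : 0 < act (x * y * z) 0 := by
    rw [act_mul, act_mul]
    exact x0.trans (strictMono_act x (y0.trans (strictMono_act y z0)))
  -- Centrality of `u` permits a cyclic shift, after which the first map applied, `x`, fixes the
  -- starting point `ang α`.
  have hcyc : y * z * x = u ^ k := by
    have h1 : y * z * x = x⁻¹ * (x * y * z) * x := by group
    rw [h1, hk, mul_assoc, u_zpow_mul_comm, inv_mul_cancel_left]
  have hup : act (y * z * x) (ang α) < ang β + 2 * Real.pi * (1 : ℤ) := by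
    rw [act_mul, act_mul, hα]
    have h1 := strictMono_act z hαδ
    -- Since `ang α < ang δ`, the map `z` cannot push `ang α` past its fixed point `ang δ < 2π`, and
    -- then `y` cannot push it past `ang β + 2π`.
    rw [hδ] at h1
    have h2 : act z (ang α) < ang β + 2 * Real.pi * (1 : ℤ) := by
      push_cast
      linarith [ang_lt δ, ang_pos β]
    have h3 := strictMono_act y h2
    rwa [act_add, hβ] at h3
  rw [hcyc, act_u_zpow] at hup
  rw [hk, act_u_zpow] at hlow
  push_cast at hup
  have hp := Real.pi_pos
  have hk0 : 0 < k := by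
    have : (0 : ℝ) < k := by
      by_contra hn
      nlinarith
    exact_mod_cast this
  have hk2 : k < 2 := by
    have : (k : ℝ) < 2 := by
      by_contra hn
      nlinarith [ang_lt β, ang_pos α]
    exact_mod_cast this
  have hk1 : k = 1 := by omega
  rw [hk, hk1, zpow_one]

theorem exists_hasLevel_of_isPositive_conj {x a : Gtilde}
    (h : IsPositive (UniversalCover.proj G (a * x * a⁻¹))) : ∃ k, HasLevel x k := by
  obtain ⟨k, hk⟩ := exists_atLevel h.mem_Xi
  refine ⟨k, ?_⟩
  have := hk.hasLevel.conj a⁻¹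
  simpa [mul_assoc] using this

theorem IsSequentialTriple.exists_hasLevel {C₁ C₂ C₃ : G} (h : IsSequentialTriple C₁ C₂ C₃)
    {z : Gtilde} (hz : UniversalCover.proj G z = C₃) : ∃ k, HasLevel z k := by
  obtain ⟨-, A, -, -, h3, -⟩ := h
  obtain ⟨a, rfl⟩ := proj_surjective A
  refine exists_hasLevel_of_isPositive_conj (a := a) ?_
  simpa [hz] using h3

/-- Multiplying by powers of `u` brings the lifts to level `0`, and conjugating by a lift of `A`
makes them positive. The extra `1` is the `u` of `mul_eq_u_of_isPositive`. -/
theorem IsSequentialTriple.mul_eq {x y z : Gtilde} {i j k : ℤ} (hx : HasLevel x i)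
    (hy : HasLevel y j) (hz : HasLevel z k)
    (h : IsSequentialTriple (UniversalCover.proj G x) (UniversalCover.proj G y)
      (UniversalCover.proj G z)) : x * y * z = u ^ (i + j + k + 1) := by
  obtain ⟨h1, A, px, py, pz, hxy, hyz⟩ := h
  obtain ⟨a, rfl⟩ := proj_surjective A
  have hproj : ∀ (w : Gtilde) (n : ℤ), UniversalCover.proj G (a * (w * u ^ n) * a⁻¹) =
      UniversalCover.proj G a * UniversalCover.proj G w * (UniversalCover.proj G a)⁻¹ := by
    intro w n
    rw [map_mul, map_mul, map_mul, map_inv, proj_u_zpow, mul_one]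
  have hlev : ∀ {w : Gtilde} {n : ℤ}, HasLevel w n → HasLevel (a * (w * u ^ (-n)) * a⁻¹) 0 := by
    intro w n hw
    have := (hw.mul_u_zpow (-n)).conj a
    rwa [add_neg_cancel] at this
  have key := mul_eq_u_of_isPositive (hlev hx) (hlev hy) (hlev hz)
    (by rwa [hproj]) (by rwa [hproj]) (by rwa [hproj]) (by rwa [hproj, hproj])
    (by rwa [hproj, hproj]) (by
      rw [map_mul, map_mul, hproj, hproj, hproj]
      have : ∀ p q r s : G, q * r * s = 1 →
          p * q * p⁻¹ * (p * r * p⁻¹) * (p * s * p⁻¹) = 1 := by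
        intro p q r s hh
        have : p * q * p⁻¹ * (p * r * p⁻¹) * (p * s * p⁻¹) = p * (q * r * s) * p⁻¹ := by group
        rw [this, hh, mul_one, mul_inv_cancel]
      exact this _ _ _ _ h1)
  have hcomb : a * (x * u ^ (-i)) * a⁻¹ * (a * (y * u ^ (-j)) * a⁻¹) *
      (a * (z * u ^ (-k)) * a⁻¹) = a * (x * y * z) * a⁻¹ * u ^ (-(i + j + k)) := by
    have e1 : a * (x * u ^ (-i)) * a⁻¹ * (a * (y * u ^ (-j)) * a⁻¹) * (a * (z * u ^ (-k)) * a⁻¹) =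
        a * x * (u ^ (-i) * y) * (u ^ (-j) * z) * (u ^ (-k) * a⁻¹) := by group
    rw [e1, u_zpow_mul_comm, u_zpow_mul_comm, u_zpow_mul_comm]
    have e2 : a * x * (y * u ^ (-i)) * (z * u ^ (-j)) * (a⁻¹ * u ^ (-k)) =
        a * x * y * (u ^ (-i) * z) * (u ^ (-j) * a⁻¹) * u ^ (-k) := by group
    rw [e2, u_zpow_mul_comm, u_zpow_mul_comm]
    have e3 : a * x * y * (z * u ^ (-i)) * (a⁻¹ * u ^ (-j)) * u ^ (-k) =
        a * x * y * z * (u ^ (-i) * a⁻¹) * u ^ (-j) * u ^ (-k) := by group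
    rw [e3, u_zpow_mul_comm]
    group
  rw [hcomb] at key
  have k1 : a * (x * y * z) * a⁻¹ = u ^ (i + j + k + 1) := by
    rw [eq_mul_inv_of_mul_eq key, ← zpow_neg, neg_neg, zpow_add u (i + j + k) 1, zpow_one]
    exact (u_zpow_mul_comm _ _).symm
  rw [mul_inv_eq_iff_eq_mul, u_zpow_mul_comm] at k1
  exact mul_left_cancel k1

/-! ### Products of lifts of sequential sets -/

/-- Each factor after the first adds its own level plus `1`. Nonemptiness of `R` is needed because
the triple that governs the last factor of `L` uses `R.prod` as third member. -/
theorem hasLevel_prod_of_append {xs : List Gtilde} (hlev : ∀ x ∈ xs, HasLevel x (level x))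
    (hseq : ∀ (L : List Gtilde) (x : Gtilde) (R : List Gtilde), xs = L ++ x :: R → L ≠ [] →
      R ≠ [] → IsSequentialTriple (UniversalCover.proj G L.prod) (UniversalCover.proj G x)
        (UniversalCover.proj G R.prod))
    (L R : List Gtilde) (h : xs = L ++ R) (hL : L ≠ []) (hR : R ≠ []) :
    HasLevel L.prod ((L.map level).sum + L.length - 1) := by
  induction L using List.reverseRecOn generalizing R with
  | nil => exact absurd rfl hL
  | append_singleton L x ih =>
    have hx : HasLevel x (level x) := hlev x (by simp [h])
    rcases eq_or_ne L [] with rfl | hL'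
    · simpa using hx
    · have h' : xs = L ++ x :: R := by simpa using h
      have hs := hseq L x R h' hL' hR
      obtain ⟨k, hk⟩ := hs.exists_hasLevel rfl
      have hprod := IsSequentialTriple.mul_eq (ih (x :: R) h' hL' (by simp)) hx hk hs
      -- The level `k` of the tail is unknown, but it cancels: it enters the exponent as `k` and the
      -- inverse of the tail as `-k`.
      have e : (L ++ [x]).prod =
          R.prod⁻¹ * u ^ ((L.map level).sum + L.length - 1 + level x + k + 1) := by
        rw [← u_zpow_mul_comm, ← hprod, mul_inv_cancel_right, List.prod_append, List.prod_singleton]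
      rw [e]
      convert hk.inv.mul_u_zpow _ using 1
      simp
      ring

/-- The triple with the last two elements as second and third members gives the exponent: the prefix
contributes its length `N - 2` minus `1`, and the triple adds `1`. -/
theorem prod_eq_u_zpow {xs : List Gtilde} (hlen : 3 ≤ xs.length)
    (hlev : ∀ x ∈ xs, HasLevel x (level x))
    (hseq : ∀ (L : List Gtilde) (x : Gtilde) (R : List Gtilde), xs = L ++ x :: R → L ≠ [] →
      R ≠ [] → IsSequentialTriple (UniversalCover.proj G L.prod) (UniversalCover.proj G x)
        (UniversalCover.proj G R.prod)) :
    xs.prod = u ^ ((xs.map level).sum + xs.length - 2) := by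
  obtain ⟨L, x, z, rfl⟩ : ∃ L x z, xs = L ++ [x, z] := by
    rcases List.eq_nil_or_concat xs with rfl | ⟨ys, z, rfl⟩
    · simp at hlen
    · rcases List.eq_nil_or_concat ys with rfl | ⟨L, x, rfl⟩
      · simp at hlen
      · exact ⟨L, x, z, by simp⟩
  have hL : L ≠ [] := by
    rintro rfl
    simp at hlen
  have h := IsSequentialTriple.mul_eq
    (hasLevel_prod_of_append hlev hseq L [x, z] rfl hL (by simp)) (hlev x (by simp))
    (hlev z (by simp)) (by simpa using hseq L x [z] rfl hL (by simp))
  have e : (L ++ [x, z]).prod = L.prod * x * z := by simp [mul_assoc]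
  rw [e, h]
  congr 1
  simp
  ring

theorem proj_out {m : ℕ} (x : Gm m) : UniversalCover.proj G (Quotient.out x) = Gm.proj m x := by
  have h : (QuotientGroup.mk (Quotient.out x) : Gm m) = x := QuotientGroup.out_eq' x
  conv_rhs => rw [← h]
  rfl

/-- Inversion negates the displacement and conjugation preserves it; hence a handle contributes
nothing to the sum of levels. -/
theorem level_add_level_conj_inv {a : Gtilde} (b : Gtilde) (ha : UniversalCover.proj G a ∈ Xi)
    (hb : UniversalCover.proj G (b * a⁻¹ * b⁻¹) ∈ Xi) :
    level a + level (b * a⁻¹ * b⁻¹) = 0 := by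
  rw [HasLevel.unique (hasLevel_level hb) ((hasLevel_level ha).inv.conj b)]
  ring

end LevelLift

end

/-! ### The relation in `G_m` -/

open LevelLift in
theorem mainTheorem9 (m : ℕ) (hm : 0 < m) (g lh lp : ℕ) (hn : 3 ≤ 2 * g + lh + lp)
    (A B : Fin g → LevelLift.Gm m) (C : Fin (lh + lp) → LevelLift.Gm m)
    (hV : LevelLift.IsSequential g lh lp (fun i => LevelLift.Gm.proj m (A i))
      (fun i => LevelLift.Gm.proj m (B i)) (fun i => LevelLift.Gm.proj m (C i))) :
    (List.ofFn fun i => A i * B i * (A i)⁻¹ * (B i)⁻¹).prod * (List.ofFn C).prod = 1 ↔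
      ∑ i, LevelLift.lev m (C i) =
        (2 - 2 * (g : ZMod m)) - ((lh : ZMod m) + (lp : ZMod m)) := by
  obtain ⟨-, -, -, -, -, hhyp, hpar, hseq⟩ := hV
  -- `lev` evaluates `level` at `Quotient.out`, so with these representatives the sum of levels in
  -- `ZMod m` is the reduction of the integral one.
  let a : Fin g → Gtilde := fun i => Quotient.out (A i)
  let b : Fin g → Gtilde := fun i => Quotient.out (B i)
  let c : Fin (lh + lp) → Gtilde := fun i => Quotient.out (C i)
  let xs : List Gtilde :=
    (List.ofFn fun i => [a i, b i * (a i)⁻¹ * (b i)⁻¹]).flatten ++ List.ofFn c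
  have hmap : xs.map (UniversalCover.proj G) =
      (List.ofFn fun i => [Gm.proj m (A i),
        Gm.proj m (B i) * (Gm.proj m (A i))⁻¹ * (Gm.proj m (B i))⁻¹]).flatten ++
        List.ofFn fun i => Gm.proj m (C i) := by
    simp only [xs, a, b, c, List.map_append, List.map_flatten, List.map_ofFn]
    congr 2
    · congr 1
      ext1 i
      simp [proj_out]
    · ext1 i
      simp [proj_out]
  rw [← hmap] at hhyp hpar hseq
  have hXi : ∀ x ∈ xs, UniversalCover.proj G x ∈ Xi := by
    intro x hx
    have hx' := List.mem_map_of_mem (f := UniversalCover.proj G) hx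
    rw [← List.take_append_drop (2 * g + lh) (xs.map _), List.mem_append] at hx'
    rcases hx' with h | h
    · exact Or.inl (hhyp _ h)
    · exact Or.inr (Or.inl (hpar _ h))
  have hlen : xs.length = 2 * g + (lh + lp) := by
    simp [xs, List.length_flatten, List.map_ofFn, Function.comp_def, mul_comm]
  have hsum : (xs.map level).sum = ∑ i, level (c i) := by
    have h0 : ∀ i, level (a i) + level (b i * (a i)⁻¹ * (b i)⁻¹) = 0 := fun i =>
      level_add_level_conj_inv (b i)
        (hXi _ (List.mem_append_left _ (List.mem_flatten.mpr
          ⟨_, List.mem_ofFn.mpr ⟨i, rfl⟩, by simp⟩)))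
        (hXi _ (List.mem_append_left _ (List.mem_flatten.mpr
          ⟨_, List.mem_ofFn.mpr ⟨i, rfl⟩, by simp⟩)))
    simp [xs, List.map_flatten, List.sum_flatten, List.map_ofFn, Function.comp_def, h0,
      List.sum_ofFn]
  have hprod : xs.prod = u ^ (∑ i, level (c i) + (2 * g + (lh + lp) : ℕ) - 2) := by
    rw [← hsum, ← hlen]
    refine prod_eq_u_zpow (by omega) (fun x hx => hasLevel_level (hXi x hx)) ?_
    rintro L x R h hL hR
    have := hseq (L.map (UniversalCover.proj G)) (UniversalCover.proj G x)
      (R.map (UniversalCover.proj G)) (by rw [h]; simp) (by simpa using hL) (by simpa using hR)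
    rwa [← map_list_prod, ← map_list_prod] at this
  have hGm : (List.ofFn fun i => A i * B i * (A i)⁻¹ * (B i)⁻¹).prod * (List.ofFn C).prod =
      QuotientGroup.mk' (mCenter m) xs.prod := by
    simp only [xs, a, b, c, List.prod_append, List.prod_flatten, map_mul, map_list_prod,
      List.map_ofFn]
    congr 3
    · ext1 i
      simp [mul_assoc]
    · ext1 i
      simp
  have hlev : ∑ i, lev m (C i) = ((∑ i, level (c i) : ℤ) : ZMod m) := by
    push_cast
    rfl
  -- The relation is now divisibility by `m` of the exponent, that is, of the sum of levels plus `2g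
  -- + lh + lp - 2`.
  rw [hGm, hprod, QuotientGroup.mk'_apply, QuotientGroup.eq_one_iff, u_zpow_mem_mCenter_iff,
    ← ZMod.intCast_zmod_eq_zero_iff_dvd, hlev]
  push_cast
  constructor <;> intro h <;> linear_combination h
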